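/- A mean-payoff game $G=(\Pi,V,(V_i)_{i\in\Pi},E,r)$ consists of finite sets $\Pi$ of players and $V$ of states, a set $E\subseteq V\times V$ of transitions such that every state has at least one outgoing transition, a partition $(V_i)_{i\in\Pi}$ of $V$ ($V_i$ being the set of states controlled by player $i$, possibly empty), and reward functions $r_i:E\to\mathbb{Q}$ for $i\in\Pi$. A play from $v_0$ is an infinite path $\rho=\rho_0\rho_1\dots$ of $(V,E)$ with $\rho_0=v_0$; its payoff vector is $\mu(\rho)=(\mu_i(\rho))_{i\in\Pi}$, where $\mu_i(\rho)=\liminf_{n\to\infty}\frac1n\sum_{k<n}r_i(\rho_k\rho_{k+1})$. For $\lambda:V\to\mathbb{R}\cup\{\pm\infty\}$ (a requirement), the play $\rho$ is $\lambda$-consistent if $\mu_i(\rho_n\rho_{n+1}\dots)\ge\lambda(\rho_n)$ for all $i\in\Pi$ and $n\in\mathbb{N}$ with $\rho_n\in V_i$. For $W\subseteq V$, let $\mathsf{SC}(W)$ be the set of simple cycles $c=c_0c_1\dots c_n$ ($n\ge 0$) of the subgraph induced by $W$, i.e. of words of pairwise distinct states of $W$ with $c_kc_{k+1}\in E$ for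 $k<n$ and $c_nc_0\in E$; let $\mathsf{MP}_i(c)=\frac1{n+1}\left(r_i(c_nc_0)+\sum_{k<n}r_i(c_kc_{k+1})\right)$. Sizes: a rational number $p/q$ in lowest terms has size $1+\lceil\log_2(|p|+1)\rceil+\lceil\log_2(|q|+1)\rceil$, an irrational number has size $+\infty$, and $\pm\infty$ have size $1$. A tuple $z=(z_d)_{d\in D}$ has size $\lVert z\rVert=\mathsf{card}\,D+\sum_{d\in D}\lVert z_d\rVert$. The size of a game is $\lVert G\rVert=\mathsf{card}\,\Pi+\mathsf{card}\,V+\mathsf{card}\,E+\lVert (r_i(e))_{(i,e)\in\Pi\times E}\rVert$, and $\lVert G,\bar x,\bar y,\lambda\rVert=\lVert G\rVert+\lVert\bar x\rVert+\lVert\bar y\rVert+\lVert\lambda\rVert$. A tuple of coefficients $\bar{\bar\alpha}\in[0,1]^{\Pi\times\mathsf{SC}(W)}$ is encoded by the list of its nonzero coefficients: $\lVert\bar{\bar\alpha}\rVert_{\mathrm{sp}}$ is the size of the tuple $(\alpha_{jc})$ restricted to the pairs $(j,c)$ with $\alpha_{jc}\ne0$. **Theorem.** There exists a polynomial $P_4$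 such that for every mean-payoff game $G$ with initial state $v_0$, all $\bar x,\bar y\in\mathbb{R}^\Pi$ and every requirement $\lambda:V\to\mathbb{R}\cup\{\pm\infty\}$, the following are equivalent: there exists a $\lambda$-consistent play $\rho$ from $v_0$ with $\bar x\le\mu(\rho)\le\bar y$ (componentwise); and there exist sets $W\subseteq W'\subseteq V$ and a tuple $\bar{\bar\alpha}\in[0,1]^{\Pi\times\mathsf{SC}(W)}$ such that: - the subgraph of $(V,E)$ induced by $W$ is strongly connected, and $W$ is accessible from $v_0$ using only and all the states of $W'$, i.e. there is a finite path from $v_0$ to a state of $W$ whose set of visited states is exactly $W'$; - for each player $i$, we have $\sum_{c}\alpha_{ic}=1$ and $x_i\le\min_{j\in\Pi}\sum_{c\in\mathsf{SC}(W)}\alpha_{jc}\mathsf{MP}_i(c)\le y_i$; - for each player $i$ and each $v\in W'\cap V_i$, we have $\min_{j\in\Pi}\sum_{c\in\mathsf{SC}(W)}\alpha_{jc}\mathsf{MP}_i(c)\ge\lambda(v)$; - $\lVert\bar{\bar\alpha}\rVert_{\mathrm{sp}}\le P_4(\lVert G,\bar x,\bar y,\lambda\rVert)$ (with $P_4(+\infty)=+\infty$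 for nonconstant $P_4$). -/

import Mathlib

open Filter

/-- A mean-payoff game with set of players `ι` and (finite) set of states `V`.  The underlying graph
is `(V, E)`, `owner v` is the player controlling `v` (so `V_i = {v | owner v = i}`), and `r i u v` is
the reward of player `i` on the transition `uv`.  Only the values of `r` on transitions matter. -/
structure MeanPayoffGame (ι V : Type*) where
  E : Set (V × V)
  exists_succ : ∀ v, ∃ w, (v, w) ∈ E
  owner : V → ι
  r : ι → V → V → ℚ

namespace MeanPayoffGame

variable {ι V : Type*} (G : MeanPayoffGame ι V)

/-- `ρ` is a play, that is, an infinite path in the underlying graph. -/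
def IsPlay (ρ : ℕ → V) : Prop := ∀ n, (ρ n, ρ (n + 1)) ∈ G.E

/-- The mean payoff of player `i` along the finite prefix `ρ_0 … ρ_n`. -/
noncomputable def prefixMP (i : ι) (ρ : ℕ → V) (n : ℕ) : ℝ :=
  (∑ k ∈ Finset.range n, (G.r i (ρ k) (ρ (k + 1)) : ℝ)) / n

/-- The payoff `μ_i(ρ)`: the limit inferior of the mean payoffs of the prefixes of `ρ`.
(When `V` is finite these mean payoffs are bounded, so this is the genuine limit inferior.) -/
noncomputable def payoff (ρ : ℕ → V) (i : ι) : ℝ :=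
  liminf (fun n => G.prefixMP i ρ n) atTop

/-- `ρ` is `lam`-consistent, for a requirement `lam : V → ℝ ∪ {±∞}`: for all `i` and `n` such that
`ρ_n` is controlled by `i`, the suffix `ρ_n ρ_{n+1} …` gives player `i` at least `lam (ρ_n)`. -/
def IsConsistent (lam : V → EReal) (ρ : ℕ → V) : Prop :=
  ∀ (i : ι) (n : ℕ), G.owner (ρ n) = i →
    lam (ρ n) ≤ ((G.payoff (fun k => ρ (n + k)) i : ℝ) : EReal)

/-- The subgraph induced by `W` is strongly connected: any two states of `W` are joined by a path
that stays in `W`. -/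
def IsStronglyConnected (W : Set V) : Prop :=
  ∀ u ∈ W, ∀ v ∈ W,
    Relation.ReflTransGen (fun a b => a ∈ W ∧ b ∈ W ∧ (a, b) ∈ G.E) u v

/-- `W` is accessible from `v₀` using only and all the states of `W'`: some history (finite path)
from `v₀` to a state of `W` visits exactly the states of `W'`. -/
def IsAccessibleVia (v₀ : V) (W W' : Set V) : Prop :=
  ∃ h : List V, h.IsChain (fun a b => (a, b) ∈ G.E) ∧ h.head? = some v₀ ∧
    (∃ w ∈ W, h.getLast? = some w) ∧ {v | v ∈ h} = W'

/-- `SC(W)`: the simple cycles `c_0 c_1 … c_n c_0` (`n ≥ 0`) of the subgraph induced by `W`.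
In `Fin (n + 1)` the successor `k + 1` of the last index is `0`, so the closing transition is
included.  The states `c_0, …, c_n` are pairwise distinct, hence `n < card V`. -/
def SimpleCycle [Fintype V] (W : Set V) : Type _ :=
  Σ n : Fin (Fintype.card V), {c : Fin ((n : ℕ) + 1) → V //
    Function.Injective c ∧ (∀ k, c k ∈ W) ∧ ∀ k, (c k, c (k + 1)) ∈ G.E}

noncomputable instance [Fintype V] (W : Set V) : Fintype (G.SimpleCycle W) := by
  classical
  unfold SimpleCycle
  exact Fintype.ofFinite _

/-- The mean payoff `MP_i(c)` of player `i` along the simple cycle `c`. -/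
noncomputable def cycleMP [Fintype V] {W : Set V} (c : G.SimpleCycle W) (i : ι) : ℝ :=
  (∑ k, (G.r i (c.2.1 k) (c.2.1 (k + 1)) : ℝ)) / ((c.1 : ℕ) + 1 : ℕ)

/-- The number `min_{j} ∑_{c ∈ SC(W)} α_{jc} MP_i(c)`, a minimum over the set of all players, which
is finite, and nonempty as soon as there is a state. -/
noncomputable def combinedMP [Fintype V] {W : Set V}
    (α : ι → G.SimpleCycle W → ℝ) (i : ι) : ℝ :=
  ⨅ j : ι, ∑ c, α j c * G.cycleMP c i

end MeanPayoffGame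

/-- The size `1 + ⌈log₂(|p| + 1)⌉ + ⌈log₂(|q| + 1)⌉` of the rational number `p / q` in lowest
terms. -/
def ratSize (x : ℚ) : ℕ :=
  1 + Nat.clog 2 (x.num.natAbs + 1) + Nat.clog 2 (x.den + 1)

/-- The size of a real number: that of the corresponding rational number if it is rational, and
`+∞` (the infimum over the empty set) if it is irrational. -/
noncomputable def realSize (x : ℝ) : ℕ∞ :=
  ⨅ (q : ℚ) (_ : (q : ℝ) = x), (ratSize q : ℕ∞)

/-- The size of an extended real number; that of `±∞` is `1`. -/
noncomputable def erealSize (x : EReal) : ℕ∞ :=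
  open Classical in if x = ⊤ ∨ x = ⊥ then 1 else realSize x.toReal

/-- The size of a tuple indexed by `D` whose entry at `d` has size `s d`. -/
def tupleSize {D : Type*} [Fintype D] (s : D → ℕ∞) : ℕ∞ :=
  (Fintype.card D : ℕ∞) + ∑ d, s d

/-- The size of a tuple of real numbers in sparse encoding: that of its restriction to the indices
at which it does not vanish. -/
noncomputable def sparseSize {D : Type*} [Fintype D] (f : D → ℝ) : ℕ∞ :=
  open Classical in tupleSize (fun d : {d : D // f d ≠ 0} => realSize (f d))

/-- The size of a mean-payoff game: number of players, of states and of transitions, plus the size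
of the tuple of the rewards of all the players on all the transitions. -/
noncomputable def MeanPayoffGame.size {ι V : Type*} [Fintype ι] [Fintype V]
    (G : MeanPayoffGame ι V) : ℕ∞ :=
  open Classical in
  (Fintype.card ι : ℕ∞) + (Fintype.card V : ℕ∞) + (Fintype.card G.E : ℕ∞) +
    tupleSize (fun d : ι × G.E => (ratSize (G.r d.1 d.2.1.1 d.2.1.2) : ℕ∞))

/-- The size of the data `(G, x, y, lam)`. -/
noncomputable def instanceSize {ι V : Type*} [Fintype ι] [Fintype V]
    (G : MeanPayoffGame ι V) (x y : ι → ℝ) (lam : V → EReal) : ℕ∞ :=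
  G.size + tupleSize (fun i => realSize (x i)) + tupleSize (fun i => realSize (y i)) +
    tupleSize (fun v => erealSize (lam v))

/-! ### Payoffs as lower limits, and their invariance under shifts -/

namespace MeanPayoffGame

variable {ι V : Type*} (G : MeanPayoffGame ι V)

/-! From a play to a certificate: let `W` be the states visited infinitely often and `W'` all the
visited states. Fix a player `j` and prefixes of a tail along which the average of `j` tends to its
liminf. Each prefix splits into simple cycles of `W` and a leftover simple path of bounded length
(`exists_cycle_decomposition`). The fractions of time spent on the cycles have a limit point `α j`
by compactness: it gives `j` exactly its payoff, and every other player at least its payoff, a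
liminf being at most any limit along a subsequence (`exists_coeff_of_play`).

The size bound is a linear programming argument, carried out separately for each `j`. Payoffs may be
irrational, so they are first replaced by lower bounds taken from the entries of `x` and `lam`
(`exists_real_lowerBound`). The conditions on `α j` then form a rational system with `card ι + 2`
rows and possibly exponentially many columns. A solution supported on independent columns is sparse,
and Cramer's rule bounds its entries (`exists_small_nonneg_solution`).

From a certificate to a play: reach a state `w` of `W` inside `W'`, then concatenate closed walks at
`w`, the `k`-th of length about `k` and with cycle frequencies close to `α (f k)`
(`exists_closed_walk_near`). Every block is worth at least the minimum over `j`, up to a bounded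
error, so the payoffs are at least `combinedMP`. Since `f` equals each `j` on intervals `[a, a ^ 2)`
with `a` arbitrarily large, whose blocks dwarf all the earlier ones, the averages come close to the
value of each `α j` infinitely often, and equality follows (`exists_play_payoff_eq_combinedMP`). -/

theorem exists_abs_reward_le [Finite ι] [Finite V] :
    ∃ R : ℝ, 0 ≤ R ∧ ∀ i u v, |(G.r i u v : ℝ)| ≤ R := by
  obtain ⟨R, hR⟩ := (Set.finite_range
    (fun d : ι × V × V => |(G.r d.1 d.2.1 d.2.2 : ℝ)|)).bddAbove
  exact ⟨max R 0, le_max_right _ _, fun i u v =>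
    (hR ⟨(i, u, v), rfl⟩).trans (le_max_left _ _)⟩

variable {G}

theorem abs_sum_reward_le {R : ℝ} (hR : ∀ i u v, |(G.r i u v : ℝ)| ≤ R) (i : ι) (ρ : ℕ → V)
    (n : ℕ) : |∑ k ∈ Finset.range n, (G.r i (ρ k) (ρ (k + 1)) : ℝ)| ≤ n * R := by
  refine (Finset.abs_sum_le_sum_abs _ _).trans ?_
  simpa using Finset.sum_le_card_nsmul (Finset.range n) _ R
    (fun k _ => hR i (ρ k) (ρ (k + 1)))

theorem abs_prefixMP_le {R : ℝ} (h0 : 0 ≤ R) (hR : ∀ i u v, |(G.r i u v : ℝ)| ≤ R) (i : ι)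
    (ρ : ℕ → V) (n : ℕ) : |G.prefixMP i ρ n| ≤ R := by
  unfold prefixMP
  rcases Nat.eq_zero_or_pos n with rfl | hn
  · simpa using h0
  · have hn' : (0 : ℝ) < n := by exact_mod_cast hn
    rw [abs_div, abs_of_pos hn', div_le_iff₀ hn', mul_comm]
    exact abs_sum_reward_le hR i ρ n

variable [Finite ι] [Finite V]

theorem isBoundedUnder_ge_prefixMP (i : ι) (ρ : ℕ → V) :
    IsBoundedUnder (· ≥ ·) atTop (fun n => G.prefixMP i ρ n) := by
  obtain ⟨R, h0, hR⟩ := G.exists_abs_reward_le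
  exact isBoundedUnder_of ⟨-R, fun n => (abs_le.1 (abs_prefixMP_le h0 hR i ρ n)).1⟩

theorem isBoundedUnder_le_prefixMP (i : ι) (ρ : ℕ → V) :
    IsBoundedUnder (· ≤ ·) atTop (fun n => G.prefixMP i ρ n) := by
  obtain ⟨R, h0, hR⟩ := G.exists_abs_reward_le
  exact isBoundedUnder_of ⟨R, fun n => (abs_le.1 (abs_prefixMP_le h0 hR i ρ n)).2⟩

theorem le_payoff_iff {i : ι} {ρ : ℕ → V} {c : ℝ} :
    c ≤ G.payoff ρ i ↔ ∀ ε > 0, ∀ᶠ n in atTop, c - ε ≤ G.prefixMP i ρ n := by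
  have hb := isBoundedUnder_ge_prefixMP (G := G) i ρ
  have hc := (isBoundedUnder_le_prefixMP (G := G) i ρ).isCoboundedUnder_ge
  constructor
  · intro h ε hε
    have : c - ε < liminf (fun n => G.prefixMP i ρ n) atTop := lt_of_lt_of_le (by linarith) h
    exact (eventually_lt_of_lt_liminf this hb).mono fun n hn => hn.le
  · intro h
    refine le_of_forall_pos_sub_le fun ε hε => ?_
    exact le_liminf_of_le hc (h ε hε)

theorem payoff_le_iff {i : ι} {ρ : ℕ → V} {c : ℝ} :
    G.payoff ρ i ≤ c ↔ ∀ ε > 0, ∃ᶠ n in atTop, G.prefixMP i ρ n ≤ c + ε := by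
  have hb := isBoundedUnder_ge_prefixMP (G := G) i ρ
  have hc := (isBoundedUnder_le_prefixMP (G := G) i ρ).isCoboundedUnder_ge
  constructor
  · intro h ε hε
    have : liminf (fun n => G.prefixMP i ρ n) atTop < c + ε := lt_of_le_of_lt h (by linarith)
    exact (frequently_lt_of_liminf_lt hc this).mono fun n hn => hn.le
  · intro h
    refine le_of_forall_pos_le_add fun ε hε => ?_
    exact liminf_le_of_frequently_le (h ε hε) hb

theorem tendsto_prefixMP_shift_sub (i : ι) (ρ : ℕ → V) (N : ℕ) :
    Tendsto (fun n => G.prefixMP i (fun k => ρ (N + k)) n - G.prefixMP i ρ (N + n)) atTop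
      (nhds 0) := by
  obtain ⟨R, h0, hR⟩ := G.exists_abs_reward_le
  have hlim : Tendsto (fun n : ℕ => (2 * N * R) / (n : ℝ)) atTop (nhds 0) :=
    tendsto_const_div_atTop_nhds_zero_nat _
  refine squeeze_zero_norm' ?_ hlim
  filter_upwards [eventually_gt_atTop 0] with n hn
  have hn' : (0 : ℝ) < n := by exact_mod_cast hn
  have hN' : (0 : ℝ) ≤ N := by positivity
  have key : G.prefixMP i (fun k => ρ (N + k)) n - G.prefixMP i ρ (N + n) =
      (N * G.prefixMP i ρ (N + n) -
        ∑ k ∈ Finset.range N, (G.r i (ρ k) (ρ (k + 1)) : ℝ)) / n := by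
    simp only [prefixMP, Finset.sum_range_add, Nat.cast_add, ← add_assoc]
    field_simp
    ring
  rw [key, Real.norm_eq_abs, abs_div, abs_of_pos hn']
  gcongr
  have h1 := abs_sum_reward_le hR i ρ N
  have h2 := abs_prefixMP_le h0 hR i ρ (N + n)
  have h3 : |(N : ℝ) * G.prefixMP i ρ (N + n)| ≤ N * R := by
    rw [abs_mul, abs_of_nonneg hN']
    gcongr
  have := abs_sub (N * G.prefixMP i ρ (N + n))
    (∑ k ∈ Finset.range N, (G.r i (ρ k) (ρ (k + 1)) : ℝ))
  linarith

/-- Dropping `N` transitions changes the averages by `O(N / n)`. This reduces consistency to one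
inequality per visited state, and lets the analysis of a play start after its transient part. -/
theorem payoff_shift (i : ι) (ρ : ℕ → V) (N : ℕ) :
    G.payoff (fun k => ρ (N + k)) i = G.payoff ρ i := by
  have ht := tendsto_prefixMP_shift_sub (G := G) i ρ N
  refine eq_of_forall_le_iff fun c => ?_
  rw [le_payoff_iff, le_payoff_iff]
  constructor
  · intro h ε hε
    have h1 := h (ε / 2) (by linarith)
    have h2 := ht.eventually (gt_mem_nhds (show (0 : ℝ) < ε / 2 by linarith))
    obtain ⟨M, hM⟩ := eventually_atTop.1 (h1.and h2)
    refine eventually_atTop.2 ⟨N + M, fun n hn => ?_⟩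
    obtain ⟨m, rfl⟩ := Nat.exists_eq_add_of_le hn
    have := hM (M + m) (by omega)
    rw [add_assoc]
    linarith [this.1, this.2]
  · intro h ε hε
    have h1 := h (ε / 2) (by linarith)
    have h2 := ht.eventually (lt_mem_nhds (show -(ε / 2) < (0 : ℝ) by linarith))
    obtain ⟨M, hM⟩ := eventually_atTop.1 h1
    filter_upwards [h2, eventually_ge_atTop M] with n hn hnM
    linarith [hM (N + n) (by omega)]

end MeanPayoffGame

/-! ### Decomposition of finite paths into simple cycles -/

namespace MeanPayoffGame

variable {ι V : Type*} {G : MeanPayoffGame ι V}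

theorem exists_simpleCycle_of_path [Fintype V] {W : Set V} (p : ℕ → V) (n : ℕ)
    (hinj : ∀ a ≤ n, ∀ b ≤ n, p a = p b → a = b) (hW : ∀ k ≤ n, p k ∈ W)
    (hE : ∀ k < n, (p k, p (k + 1)) ∈ G.E) (hc : (p n, p 0) ∈ G.E) :
    ∃ c : G.SimpleCycle W, (c.1 : ℕ) = n ∧ ∀ i, ((n : ℝ) + 1) * G.cycleMP c i =
      ∑ k ∈ Finset.range n, (G.r i (p k) (p (k + 1)) : ℝ) + G.r i (p n) (p 0) := by
  have hinj' : Function.Injective (fun k : Fin (n + 1) => p k) := fun a b h =>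
    Fin.ext (hinj a (by omega) b (by omega) h)
  have hcard : n < Fintype.card V := by
    simpa using Fintype.card_le_of_injective _ hinj'
  refine ⟨⟨⟨n, hcard⟩, fun k => p k, hinj', fun k =>
    hW k (Nat.lt_succ_iff.1 k.2), fun k => ?_⟩, rfl,
    fun i => ?_⟩
  · change (p (k : Fin (n + 1)), p ((k + 1 : Fin (n + 1)) : ℕ)) ∈ G.E
    induction k using Fin.lastCases with
    | last => simpa using hc
    | cast k => simpa [Fin.coeSucc_eq_succ] using hE k k.2
  · unfold cycleMP
    change ((n : ℝ) + 1) * ((∑ k : Fin (n + 1), (G.r i (p k) (p ((k + 1 : Fin (n + 1)) : ℕ)) : ℝ))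
      / ((n + 1 : ℕ) : ℝ)) = _
    rw [Fin.sum_univ_castSucc, Nat.cast_add, Nat.cast_one, mul_div_cancel₀ _ (by positivity)]
    simp [Fin.coeSucc_eq_succ, Finset.sum_range]

/-- The path `p` is a stack: each new state is pushed, unless it already occurs, in which case the
loop it closes is popped as a simple cycle. The weight `β c` counts the transitions spent on `c`,
not the passages through it, so that weights add up to lengths and `β c * cycleMP c i` is a total
reward. -/
theorem exists_cycle_decomposition [Fintype V] {W : Set V} {σ : ℕ → V} (hσ : G.IsPlay σ)
    (hW : ∀ n, σ n ∈ W) (n : ℕ) :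
    ∃ (β : G.SimpleCycle W → ℝ) (p : ℕ → V) (m : ℕ), (∀ c, 0 ≤ β c) ∧ p m = σ n ∧
      (∀ a ≤ m, ∀ b ≤ m, p a = p b → a = b) ∧ (∀ k ≤ m, p k ∈ W) ∧
      (∀ k < m, (p k, p (k + 1)) ∈ G.E) ∧ (n : ℝ) = ∑ c, β c + m ∧
      ∀ i, ∑ k ∈ Finset.range n, (G.r i (σ k) (σ (k + 1)) : ℝ) =
        ∑ c, β c * G.cycleMP c i + ∑ k ∈ Finset.range m, (G.r i (p k) (p (k + 1)) : ℝ) := by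
  classical
  induction n with
  | zero =>
    refine ⟨0, fun _ => σ 0, 0, fun c => le_rfl, rfl, ?_, fun _ _ => hW 0, ?_, by simp, by simp⟩
    · intro a ha b hb _; omega
    · intro k hk; omega
  | succ n ih =>
    obtain ⟨β, p, m, hβ, hpm, hinj, hpW, hpE, hlen, hsum⟩ := ih
    have hstep : (p m, σ (n + 1)) ∈ G.E := hpm ▸ hσ n
    by_cases hv : ∃ a ≤ m, p a = σ (n + 1)
    · obtain ⟨a, ham, hpa⟩ := hv
      obtain ⟨b, rfl⟩ := Nat.exists_eq_add_of_le ham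
      obtain ⟨c, hc, hcMP⟩ := exists_simpleCycle_of_path (G := G) (W := W) (fun k => p (a + k)) b
        (fun x hx y hy h => by have := hinj _ (by omega) _ (by omega) h; omega)
        (fun k hk => hpW _ (by omega)) (fun k hk => hpE (a + k) (by omega))
        (by simpa [hpa] using hstep)
      have hupd : ∀ f : G.SimpleCycle W → ℝ,
          ∑ c', (β c' + if c' = c then (b : ℝ) + 1 else 0) * f c' =
            ∑ c', β c' * f c' + (b + 1) * f c := by
        intro f
        simp [add_mul, Finset.sum_add_distrib]
      refine ⟨fun c' => β c' + if c' = c then (b : ℝ) + 1 else 0, p, a, ?_, hpa,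
        fun x hx y hy => hinj x (by omega) y (by omega), fun k hk => hpW k (by omega),
        fun k hk => hpE k (by omega), ?_, fun i => ?_⟩
      · intro c'
        have := hβ c'
        dsimp only
        split_ifs <;> positivity
      · have := hupd 1
        simp only [Pi.one_apply, mul_one] at this
        rw [this]
        push_cast at hlen ⊢
        linarith
      · rw [hupd, hcMP, Finset.sum_range_succ, hsum, Finset.sum_range_add, ← hpm]
        simp only [add_zero, hpa, add_assoc]
        ring
    · push Not at hv
      refine ⟨β, Function.update p (m + 1) (σ (n + 1)), m + 1, hβ, by simp, ?_, ?_, ?_, ?_, ?_⟩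
      · intro a ha b hb h
        rcases Nat.le_succ_iff.1 ha with ha | rfl <;> rcases Nat.le_succ_iff.1 hb with hb | rfl
        · rw [Function.update_of_ne (by omega), Function.update_of_ne (by omega)] at h
          exact hinj a ha b hb h
        · rw [Function.update_of_ne (by omega), Function.update_self] at h
          exact absurd h (hv a ha)
        · rw [Function.update_self, Function.update_of_ne (by omega)] at h
          exact absurd h.symm (hv b hb)
        · rfl
      · intro k hk
        rcases Nat.le_succ_iff.1 hk with hk | rfl
        · rw [Function.update_of_ne (by omega)]
          exact hpW k hk
        · simpa using hW (n + 1)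
      · intro k hk
        rcases Nat.lt_succ_iff_lt_or_eq.1 hk with hk | rfl
        · rw [Function.update_of_ne (by omega), Function.update_of_ne (by omega)]
          exact hpE k hk
        · simpa using hstep
      · push_cast
        linarith
      · intro i
        rw [Finset.sum_range_succ, Finset.sum_range_succ _ m, hsum i, ← hpm]
        have : ∑ k ∈ Finset.range m, (G.r i (Function.update p (m + 1) (σ (n + 1)) k)
            (Function.update p (m + 1) (σ (n + 1)) (k + 1)) : ℝ) =
            ∑ k ∈ Finset.range m, (G.r i (p k) (p (k + 1)) : ℝ) := by
          refine Finset.sum_congr rfl fun k hk => ?_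
          have := Finset.mem_range.1 hk
          rw [Function.update_of_ne (by omega), Function.update_of_ne (by omega)]
        rw [this]
        simp [add_assoc]

end MeanPayoffGame

/-! ### Limit frequencies of cycles, and the states visited infinitely often -/

namespace MeanPayoffGame

variable {ι V : Type*} {G : MeanPayoffGame ι V}

theorem exists_coeff_of_play [Finite ι] [Fintype V] {W : Set V} {σ : ℕ → V} (hσ : G.IsPlay σ)
    (hW : ∀ n, σ n ∈ W) (j : ι) :
    ∃ α : G.SimpleCycle W → ℝ, (∀ c, 0 ≤ α c) ∧ ∑ c, α c = 1 ∧
      (∀ i, G.payoff σ i ≤ ∑ c, α c * G.cycleMP c i) ∧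
      ∑ c, α c * G.cycleMP c j ≤ G.payoff σ j := by
  classical
  obtain ⟨R, h0, hR⟩ := G.exists_abs_reward_le
  choose β p m hβ hpm hinj hpW hpE hlen hsum using exists_cycle_decomposition hσ hW
  have hm : ∀ n, (m n : ℝ) ≤ Fintype.card V := fun n => by
    have : Function.Injective (fun k : Fin (m n) => p n k) := fun a b h =>
      Fin.ext (hinj n a (by omega) b (by omega) h)
    exact_mod_cast (by simpa using Fintype.card_le_of_injective _ this)
  -- Prefixes nearly attaining the liminf of player `j`; the bound `k + 1` makes them nonempty as
  -- well as arbitrarily long.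
  have hfreq : ∀ k : ℕ, ∃ n, k + 1 ≤ n ∧ G.prefixMP j σ n ≤ G.payoff σ j + 1 / ((k : ℝ) + 1) :=
    fun k => by
      obtain ⟨n, hn, h⟩ := (frequently_atTop.1 (payoff_le_iff.1 (le_refl (G.payoff σ j))
        (1 / ((k : ℝ) + 1)) (by positivity))) (k + 1)
      exact ⟨n, hn, h⟩
  choose φ hφ hφj using hfreq
  have hφpos : ∀ k, (0 : ℝ) < φ k := fun k => by exact_mod_cast (by have := hφ k; omega)
  have hφtop : Tendsto φ atTop atTop :=
    tendsto_atTop_mono (fun k => (Nat.le_succ k).trans (hφ k)) tendsto_id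
  have hmem : ∀ k, (fun c => β (φ k) c / φ k) ∈
      Set.Icc (0 : G.SimpleCycle W → ℝ) (fun _ => 1) := by
    refine fun k => ⟨fun c => div_nonneg (hβ _ c) (hφpos k).le, fun c => ?_⟩
    change β (φ k) c / φ k ≤ 1
    rw [div_le_one (hφpos k), hlen (φ k)]
    have := Finset.single_le_sum (fun c _ => hβ (φ k) c) (Finset.mem_univ c)
    have : (0 : ℝ) ≤ m (φ k) := by positivity
    linarith
  obtain ⟨α, hα, ψ, hψ, hlim⟩ := isCompact_Icc.tendsto_subseq hmem
  have hθ : Tendsto (fun k => φ (ψ k)) atTop atTop := hφtop.comp hψ.tendsto_atTop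
  have hcomb : ∀ f : G.SimpleCycle W → ℝ, Tendsto
      (fun k => (∑ c, β (φ (ψ k)) c * f c) / φ (ψ k)) atTop (nhds (∑ c, α c * f c)) := by
    intro f
    have := tendsto_finsetSum Finset.univ fun c _ =>
      ((tendsto_pi_nhds.1 hlim) c).mul_const (f c)
    refine this.congr fun k => ?_
    rw [Finset.sum_div]
    refine Finset.sum_congr rfl fun c _ => ?_
    simp only [Function.comp]
    ring
  have herr : ∀ (C : ℝ) (e : ℕ → ℝ), (∀ n, |e n| ≤ C) →
      Tendsto (fun k => e (φ (ψ k)) / φ (ψ k)) atTop (nhds 0) := by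
    intro C e he
    refine squeeze_zero_norm (fun k => ?_)
      ((tendsto_const_div_atTop_nhds_zero_nat C).comp hθ)
    rw [Real.norm_eq_abs, abs_div, abs_of_pos (hφpos _)]
    exact div_le_div_of_nonneg_right (he _) (hφpos _).le
  have hMP : ∀ i, Tendsto (fun k => G.prefixMP i σ (φ (ψ k))) atTop
      (nhds (∑ c, α c * G.cycleMP c i)) := by
    intro i
    have h := (hcomb fun c => G.cycleMP c i).add (herr (Fintype.card V * R)
      (fun n => ∑ k ∈ Finset.range (m n), (G.r i (p n k) (p n (k + 1)) : ℝ))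
      (fun n => (abs_sum_reward_le hR i (p n) (m n)).trans
        (mul_le_mul_of_nonneg_right (hm n) h0)))
    rw [add_zero] at h
    refine h.congr fun k => ?_
    rw [prefixMP, hsum, add_div]
  refine ⟨α, fun c => hα.1 c, ?_, fun i => ?_, ?_⟩
  · have h := (hcomb 1).add (herr (Fintype.card V) (fun n => m n) fun n => by
      rw [abs_of_nonneg (by positivity)]; exact hm n)
    simp only [Pi.one_apply, mul_one, add_zero] at h
    refine tendsto_nhds_unique h (tendsto_const_nhds.congr fun k => ?_)
    rw [← add_div, ← hlen, div_self (hφpos _).ne']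
  · refine le_of_forall_pos_sub_le fun ε hε => ?_
    exact ge_of_tendsto (hMP i) (hθ.eventually (le_payoff_iff.1 le_rfl ε hε))
  · have h : Tendsto (fun k => G.payoff σ j + 1 / ((ψ k : ℝ) + 1)) atTop
        (nhds (G.payoff σ j + 0)) :=
      (tendsto_one_div_add_atTop_nhds_zero_nat.comp hψ.tendsto_atTop).const_add _
    rw [add_zero] at h
    exact le_of_tendsto_of_tendsto' (hMP j) h fun k => hφj (ψ k)

/-- The set of states visited infinitely often. -/
def infStates (ρ : ℕ → V) : Set V := {v | ∃ᶠ n in atTop, ρ n = v}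

theorem exists_forall_ge_mem_infStates [Finite V] (ρ : ℕ → V) :
    ∃ N, ∀ n, ρ (N + n) ∈ infStates ρ := by
  have h : ∀ᶠ n in atTop, ∀ v, v ∉ infStates ρ → ρ n ≠ v := by
    refine eventually_all.2 fun v => ?_
    by_cases hv : v ∈ infStates ρ
    · exact Eventually.of_forall fun n h => absurd hv h
    · exact (not_frequently.1 hv).mono fun n hn _ => hn
  obtain ⟨N, hN⟩ := eventually_atTop.1 h
  exact ⟨N, fun n => by_contra fun hn => hN (N + n) (by omega) _ hn rfl⟩

theorem reflTransGen_of_isPlay {ρ : ℕ → V} {W : Set V} (hρ : G.IsPlay ρ) {N : ℕ}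
    (hW : ∀ n, ρ (N + n) ∈ W) {a : ℕ} (ha : N ≤ a) (b : ℕ) :
    Relation.ReflTransGen (fun u v => u ∈ W ∧ v ∈ W ∧ (u, v) ∈ G.E) (ρ a) (ρ (a + b)) := by
  obtain ⟨a, rfl⟩ := Nat.exists_eq_add_of_le ha
  induction b with
  | zero => exact .refl
  | succ b ih =>
    rw [add_assoc] at ih ⊢
    exact ih.tail ⟨hW _, hW _, hρ (N + (a + b))⟩

theorem isStronglyConnected_infStates [Finite V] {ρ : ℕ → V} (hρ : G.IsPlay ρ) :
    G.IsStronglyConnected (infStates ρ) := by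
  obtain ⟨N, hN⟩ := exists_forall_ge_mem_infStates ρ
  intro u hu v hv
  obtain ⟨a, ha, rfl⟩ := frequently_atTop.1 hu N
  obtain ⟨b, hb, rfl⟩ := frequently_atTop.1 hv a
  obtain ⟨b, rfl⟩ := Nat.exists_eq_add_of_le hb
  exact reflTransGen_of_isPlay hρ hN ha b

theorem isAccessibleVia_infStates [Finite V] {ρ : ℕ → V} (hρ : G.IsPlay ρ) :
    G.IsAccessibleVia (ρ 0) (infStates ρ) (Set.range ρ) := by
  obtain ⟨N, hN⟩ := exists_forall_ge_mem_infStates ρ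
  -- One visit is recorded for each state. Past the last recorded visit, `N` further steps make the
  -- history end in a recurrent state.
  choose f hf using fun v : Set.range ρ => v.2
  obtain ⟨M, hM⟩ := (Set.finite_range f).bddAbove
  have hlast : (List.range (N + M + 1)).getLast? = some (N + M) := by
    simp [List.range_succ]
  refine ⟨(List.range (N + M + 1)).map ρ, ?_, by simp [List.range_succ_eq_map],
    ⟨ρ (N + M), hN M, by simp [List.getLast?_map, hlast]⟩, ?_⟩
  · rw [List.isChain_iff_getElem]
    intro k hk
    simpa using hρ k
  · ext v
    simp only [List.mem_map, List.mem_range, Set.mem_ofPred_eq, Set.mem_range]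
    refine ⟨fun ⟨n, _, h⟩ => ⟨n, h⟩, fun h => ⟨f ⟨v, h⟩, ?_, hf ⟨v, h⟩⟩⟩
    have := hM ⟨⟨v, h⟩, rfl⟩
    omega

end MeanPayoffGame

/-! ### Sparse nonnegative solutions of linear systems with bounded entries -/

theorem sum_subtype_eq_of_forall_eq_zero {N : Type*} [Fintype N] {P : N → Prop} [DecidablePred P]
    (f : N → ℝ) (hf : ∀ n, ¬P n → f n = 0) : ∑ n : {n // P n}, f n = ∑ n, f n := by
  rw [← Finset.sum_filter_of_ne (p := P) fun n _ h => by_contra fun hP => h (hf n hP),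
    Finset.sum_subtype (Finset.univ.filter P) (p := P) (by simp)]

/-- Carathéodory's argument: a dependence among the columns in the support is a kernel direction,
along which one moves until a first coordinate vanishes. The support shrinks strictly, whence the
induction on its cardinality. -/
theorem exists_mulVec_eq_linearIndependent {M N : Type*} [Finite M] [Fintype N]
    (A : Matrix M N ℝ) (b : M → ℝ) (u : N → ℝ) (hu : ∀ n, 0 ≤ u n) (hA : A.mulVec u = b) :
    ∃ u' : N → ℝ, (∀ n, 0 ≤ u' n) ∧ A.mulVec u' = b ∧
      LinearIndependent ℝ (fun n : {n // u' n ≠ 0} => A.col n) := by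
  classical
  induction h : (Finset.univ.filter fun n => u n ≠ 0).card using Nat.strong_induction_on
    generalizing u with
  | _ s ih =>
  by_cases hli : LinearIndependent ℝ (fun n : {n // u n ≠ 0} => A.col n)
  · exact ⟨u, hu, hA, hli⟩
  obtain ⟨w, hwu, hAw, n₀, hn₀⟩ : ∃ w : N → ℝ, (∀ n, u n = 0 → w n = 0) ∧ A.mulVec w = 0 ∧
      ∃ n, 0 < w n := by
    obtain ⟨g, hg, n, hn⟩ := Fintype.not_linearIndependent_iff.1 hli
    let w : N → ℝ := fun n => if h : u n ≠ 0 then g ⟨n, h⟩ else 0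
    have hw : ∀ n, u n = 0 → w n = 0 := fun n h => dif_neg (not_not.2 h)
    have hAw : A.mulVec w = 0 := by
      rw [← hg]
      ext m
      simp only [Matrix.mulVec, dotProduct, Finset.sum_apply, Pi.smul_apply, smul_eq_mul,
        Matrix.col_apply]
      rw [← sum_subtype_eq_of_forall_eq_zero (P := fun n => u n ≠ 0) _
        fun n hn => by simp [hw n (not_not.1 hn)]]
      refine Finset.sum_congr rfl fun n _ => ?_
      simp only [w, dif_pos n.2]
      exact mul_comm _ _
    rcases lt_or_gt_of_ne hn with h | h
    · refine ⟨-w, fun n h => by simp [hw n h], by simp [Matrix.mulVec_neg, hAw], n, ?_⟩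
      simpa [w, n.2] using h
    · exact ⟨w, hw, hAw, n, by simpa [w, n.2] using h⟩
  obtain ⟨n₁, hn₁, hmin⟩ := Finset.exists_min_image (Finset.univ.filter fun n => 0 < w n)
    (fun n => u n / w n) ⟨n₀, by simpa using hn₀⟩
  simp only [Finset.mem_filter, Finset.mem_univ, true_and] at hn₁ hmin
  set t := u n₁ / w n₁ with ht
  have ht0 : 0 ≤ t := div_nonneg (hu _) hn₁.le
  have hzero : u n₁ - t * w n₁ = 0 := by rw [ht]; field_simp; ring
  refine ih _ ?_ (fun n => u n - t * w n) (fun n => ?_) ?_ rfl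
  · rw [← h]
    refine Finset.card_lt_card (Finset.ssubset_iff_of_subset ?_ |>.2 ⟨n₁, ?_, ?_⟩)
    · intro n hn
      simp only [Finset.mem_filter, Finset.mem_univ, true_and] at hn ⊢
      intro h0
      exact hn (by simp [h0, hwu n h0])
    · simp only [Finset.mem_filter, Finset.mem_univ, true_and]
      intro h0
      exact hn₁.ne' (hwu _ h0)
    · simpa using hzero
  · rw [sub_nonneg]
    rcases lt_or_ge 0 (w n) with hw | hw
    · exact (le_div_iff₀ hw).1 (hmin n hw)
    · exact (mul_nonpos_of_nonneg_of_nonpos ht0 hw).trans (hu n)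
  · have : (fun n => u n - t * w n) = u - t • w := rfl
    rw [this, Matrix.mulVec_sub, Matrix.mulVec_smul, hAw, hA]
    simp

theorem Matrix.abs_det_le_of_forall_abs_le {S : Type*} [Fintype S] [DecidableEq S]
    {A : Matrix S S ℤ} {x : ℤ} (h : ∀ i j, |A i j| ≤ x) :
    |A.det| ≤ (Fintype.card S).factorial * x ^ Fintype.card S := by
  simpa using Matrix.det_le (abv := AbsoluteValue.abs) h

theorem abs_dotProduct_le {M : Type*} [Fintype M] {v w : M → ℤ} {B : ℤ}
    (hv : ∀ m, |v m| ≤ B) (hw : ∀ m, |w m| ≤ B) :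
    |v ⬝ᵥ w| ≤ Fintype.card M * B ^ 2 := by
  refine (Finset.abs_sum_le_sum_abs _ _).trans ?_
  refine (Finset.sum_le_card_nsmul _ _ (B ^ 2) fun m _ => ?_).trans_eq (by simp)
  rw [abs_mul, sq]
  exact mul_le_mul (hv m) (hw m) (abs_nonneg _) ((abs_nonneg _).trans (hv m))

/-- The matrix need not be square, so Cramer's rule is applied to the normal equations: `Aᵀ * A` is
invertible because the columns of `A` are independent, and its entries are bounded by `card M * B ^
2`. -/
theorem exists_intCast_div_of_mulVec_eq {M S : Type*} [Fintype M] [Fintype S]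
    (A : Matrix M S ℤ) (b : M → ℤ) {B : ℤ} (hA : ∀ m n, |A m n| ≤ B)
    (hb : ∀ m, |b m| ≤ B) (u : S → ℝ) (hu : (A.map (Int.cast : ℤ → ℝ)).mulVec u = fun m => (b m : ℝ))
    (hli : LinearIndependent ℝ (A.map (Int.cast : ℤ → ℝ)).col) (n : S) :
    ∃ p q : ℤ, q ≠ 0 ∧ u n = p / q ∧
      |p| ≤ (Fintype.card S).factorial * (Fintype.card M * B ^ 2) ^ Fintype.card S ∧
      |q| ≤ (Fintype.card S).factorial * (Fintype.card M * B ^ 2) ^ Fintype.card S := by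
  classical
  set K := A.transpose * A with hK
  set d := A.transpose.mulVec b with hd
  set A' := A.map (Int.cast : ℤ → ℝ) with hA'
  have hK' : K.map (Int.castRingHom ℝ) = A'.transpose * A' := by
    rw [hK, Matrix.map_mul, Matrix.transpose_map]; rfl
  have hdet : K.det ≠ 0 := by
    intro h0
    have h1 : (A'.transpose * A').det = 0 := by
      rw [← hK', ← RingHom.mapMatrix_apply, ← RingHom.map_det, h0, map_zero]
    obtain ⟨v, hv, hv0⟩ := Matrix.exists_mulVec_eq_zero_iff.2 h1
    have h2 : A'.mulVec v = 0 := by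
      rw [← Matrix.conjTranspose_mul_self_mulVec_eq_zero,
        Matrix.conjTranspose_eq_transpose_of_trivial]
      exact hv0
    exact hv (Matrix.mulVec_injective_iff.2 hli (by rw [h2, Matrix.mulVec_zero]))
  have hKu : (K.map (Int.castRingHom ℝ)).mulVec u = (Int.castRingHom ℝ) ∘ d := by
    rw [hK', ← Matrix.mulVec_mulVec, hu]
    ext n
    rw [Function.comp, hd, RingHom.map_mulVec, Matrix.transpose_map]
    rfl
  have hcr : (K.det : ℝ) * u n = (K.cramer d n : ℤ) := by
    have h1 : ((K.map (Int.castRingHom ℝ)).adjugate).mulVec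
        ((K.map (Int.castRingHom ℝ)).mulVec u) = (K.det : ℝ) • u := by
      rw [Matrix.mulVec_mulVec, Matrix.adjugate_mul, Matrix.smul_mulVec, Matrix.one_mulVec,
        ← RingHom.mapMatrix_apply, ← RingHom.map_det]
      rfl
    rw [hKu, ← RingHom.mapMatrix_apply, ← RingHom.map_adjugate] at h1
    have h2 := congrFun h1 n
    rw [RingHom.mapMatrix_apply, ← RingHom.map_mulVec, ← Matrix.cramer_eq_adjugate_mulVec] at h2
    simpa using h2.symm
  have hKB : ∀ i j, |K i j| ≤ Fintype.card M * B ^ 2 := fun i j =>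
    abs_dotProduct_le (fun m => hA m i) (fun m => hA m j)
  have hdB : ∀ i, |d i| ≤ Fintype.card M * B ^ 2 := fun i =>
    abs_dotProduct_le (fun m => hA m i) hb
  refine ⟨K.cramer d n, K.det, hdet, ?_, ?_, Matrix.abs_det_le_of_forall_abs_le hKB⟩
  · rw [eq_div_iff (by exact_mod_cast hdet), mul_comm, hcr]
  · rw [Matrix.cramer_apply]
    refine Matrix.abs_det_le_of_forall_abs_le fun i j => ?_
    rw [Matrix.updateCol_apply]
    split_ifs
    · exact hdB i
    · exact hKB i j

theorem factorial_mul_pow_le_two_pow {k m β : ℕ} (hkm : k ≤ m) :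
    k.factorial * (m * (2 ^ β) ^ 2) ^ k ≤ 2 ^ (2 * m ^ 2 + 2 * β * m) := by
  have hm : m ≤ 2 ^ m := Nat.lt_two_pow_self.le
  have h1 : k.factorial ≤ (2 ^ m) ^ m :=
    (Nat.factorial_le hkm).trans ((Nat.factorial_le_pow m).trans (Nat.pow_le_pow_left hm m))
  have h2 : (m * (2 ^ β) ^ 2) ^ k ≤ (2 ^ m * (2 ^ β) ^ 2) ^ m :=
    (Nat.pow_le_pow_left (Nat.mul_le_mul_right _ hm) k).trans
      (Nat.pow_le_pow_right (by positivity) hkm)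
  calc _ ≤ (2 ^ m) ^ m * (2 ^ m * (2 ^ β) ^ 2) ^ m := Nat.mul_le_mul h1 h2
    _ = _ := by ring

theorem ratSize_le_of_eq_div {p q : ℤ} {k : ℕ} (hq : q ≠ 0) (hp : |p| ≤ 2 ^ k) (hqk : |q| ≤ 2 ^ k) :
    ratSize (p / q) ≤ 1 + 2 * (k + 1) := by
  have h2 : (2 : ℕ) ^ k + 1 ≤ 2 ^ (k + 1) := by
    rw [pow_succ]; have := Nat.one_le_two_pow (n := k); omega
  have e : (p / q : ℚ) = Rat.divInt p q := by rw [Rat.divInt_eq_div]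
  have hnum : (p / q : ℚ).num.natAbs ≤ 2 ^ k := by
    by_cases hp0 : p = 0
    · simp [hp0]
    · have h := Int.natAbs_le_of_dvd_ne_zero (e ▸ Rat.num_dvd p hq) hp0
      refine h.trans ?_
      zify
      exact hp
  have hden : (p / q : ℚ).den ≤ 2 ^ k := by
    have h := Int.natAbs_le_of_dvd_ne_zero (e ▸ Rat.den_dvd p q) hq
    rw [Int.natAbs_natCast] at h
    refine h.trans ?_
    zify
    exact hqk
  have h3 := Nat.clog_le_of_le_pow (b := 2) (x := (p / q : ℚ).num.natAbs + 1) (y := k + 1) (by omega)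
  have h4 := Nat.clog_le_of_le_pow (b := 2) (x := (p / q : ℚ).den + 1) (y := k + 1) (by omega)
  unfold ratSize
  omega

theorem realSize_ratCast (q : ℚ) : realSize (q : ℝ) = ratSize q := by
  refine le_antisymm (iInf₂_le_of_le q rfl le_rfl) (le_iInf₂ fun q' h => ?_)
  rw [Rat.cast_injective h]

/-- A nonnegative solution of a linear system with integer data can be chosen sparse and with
entries of polynomial size. -/
theorem exists_small_nonneg_solution {M N : Type*} [Fintype M] [Fintype N] (A : Matrix M N ℤ)
    (b : M → ℤ) (β : ℕ) (hA : ∀ m n, |A m n| ≤ 2 ^ β) (hb : ∀ m, |b m| ≤ 2 ^ β) (u : N → ℝ)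
    (hu0 : ∀ n, 0 ≤ u n) (hu : (A.map (Int.cast : ℤ → ℝ)).mulVec u = fun m => (b m : ℝ)) :
    ∃ u' : N → ℝ, (∀ n, 0 ≤ u' n) ∧ (A.map (Int.cast : ℤ → ℝ)).mulVec u' = (fun m => (b m : ℝ)) ∧
      Nat.card {n // u' n ≠ 0} ≤ Fintype.card M ∧
      ∀ n, u' n ≠ 0 → realSize (u' n) ≤
        ((1 + 2 * (2 * Fintype.card M ^ 2 + 2 * β * Fintype.card M + 1) : ℕ) : ℕ∞) := by
  classical
  obtain ⟨u', hu'0, hu', hli⟩ := exists_mulVec_eq_linearIndependent _ _ u hu0 hu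
  have hcard : Fintype.card {n // u' n ≠ 0} ≤ Fintype.card M := by
    simpa using hli.fintype_card_le_finrank
  refine ⟨u', hu'0, hu', by rwa [Nat.card_eq_fintype_card], fun n hn => ?_⟩
  have hsub : ((A.submatrix id ((↑) : {n // u' n ≠ 0} → N)).map (Int.cast : ℤ → ℝ)).mulVec
      (fun n => u' n) = fun m => (b m : ℝ) := by
    rw [← hu']
    ext m
    simp only [Matrix.mulVec, dotProduct]
    exact sum_subtype_eq_of_forall_eq_zero (fun n => (A.map (Int.cast : ℤ → ℝ)) m n * u' n)
      fun n hn => by simp [not_not.1 hn]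
  obtain ⟨p, q, hq, hpq, hp, hqq⟩ := exists_intCast_div_of_mulVec_eq
    (A.submatrix id ((↑) : {n // u' n ≠ 0} → N)) b (fun m n => hA m n) hb (fun n => u' n) hsub hli
    ⟨n, hn⟩
  have hΔ := factorial_mul_pow_le_two_pow (β := β) hcard
  have hΔ' : (((Fintype.card {n // u' n ≠ 0}).factorial *
      (Fintype.card M * (2 ^ β) ^ 2) ^ Fintype.card {n // u' n ≠ 0} : ℤ)) ≤
      2 ^ (2 * Fintype.card M ^ 2 + 2 * β * Fintype.card M) := by exact_mod_cast hΔ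
  have e : u' n = ((p / q : ℚ) : ℝ) := by rw [hpq]; push_cast; rfl
  rw [e, realSize_ratCast]
  exact_mod_cast ratSize_le_of_eq_div hq (hp.trans hΔ') (hqq.trans hΔ')

/-- If a point of the convex hull of finitely many points satisfies lower bounds on all
coordinates and an upper bound on one of them, then another one does that is a convex combination
with a sparse tuple of coefficients of polynomial size. -/
theorem exists_small_coeff {ι C : Type*} [Fintype ι] [Fintype C] (a : C → ι → ℝ) (l : ι → ℝ)
    (y : ℝ) (j : ι) (D β : ℕ) (ha : ∀ c i, ∃ z : ℤ, (D : ℝ) * a c i = z ∧ |z| ≤ 2 ^ β)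
    (hl : ∀ i, ∃ z : ℤ, (D : ℝ) * l i = z ∧ |z| ≤ 2 ^ β)
    (hy : ∃ z : ℤ, (D : ℝ) * y = z ∧ |z| ≤ 2 ^ β) (hD : 0 < D) (α : C → ℝ)
    (h0 : ∀ c, 0 ≤ α c) (h1 : ∑ c, α c = 1) (hlα : ∀ i, l i ≤ ∑ c, α c * a c i)
    (hyα : ∑ c, α c * a c j ≤ y) :
    ∃ α' : C → ℝ, (∀ c, 0 ≤ α' c) ∧ ∑ c, α' c = 1 ∧ (∀ i, l i ≤ ∑ c, α' c * a c i) ∧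
      ∑ c, α' c * a c j ≤ y ∧ Nat.card {c // α' c ≠ 0} ≤ Fintype.card ι + 2 ∧
      ∀ c, α' c ≠ 0 → realSize (α' c) ≤
        ((1 + 2 * (2 * (Fintype.card ι + 2) ^ 2 + 2 * β * (Fintype.card ι + 2) + 1) : ℕ) : ℕ∞) := by
  classical
  choose za hza hzaβ using ha
  choose zl hzl hzlβ using hl
  obtain ⟨zy, hzy, hzyβ⟩ := hy
  have hD' : (0 : ℝ) < D := by exact_mod_cast hD
  have hβ : (1 : ℤ) ≤ 2 ^ β := one_le_pow₀ (by norm_num)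
  -- Row `none` says that the coefficients sum to `1`, row `some none` is the upper bound for `j`,
  -- and row `some (some i)` the lower bound for `i`. The columns `.inr` are slack variables, and
  -- all rows but the first are multiplied by `D`.
  let A : Matrix (Option (Option ι)) (C ⊕ Option ι) ℤ := fun m n => match m, n with
    | none, .inl _ => 1
    | none, .inr _ => 0
    | some none, .inl c => za c j
    | some none, .inr none => 1
    | some none, .inr (some _) => 0
    | some (some i), .inl c => za c i
    | some (some _), .inr none => 0
    | some (some i), .inr (some i') => if i = i' then -1 else 0
  let b : Option (Option ι) → ℤ := fun m => match m with
    | none => 1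
    | some none => zy
    | some (some i) => zl i
  have hrow : ∀ u : C ⊕ Option ι → ℝ, (A.map (Int.cast : ℤ → ℝ)).mulVec u = (fun m => (b m : ℝ)) ↔
      ∑ c, u (.inl c) = 1 ∧ ∑ c, D * (u (.inl c) * a c j) + u (.inr none) = D * y ∧
      ∀ i, ∑ c, D * (u (.inl c) * a c i) - u (.inr (some i)) = D * l i := by
    intro u
    have e : ∀ i, ∑ c, (D : ℝ) * (u (.inl c) * a c i) = ∑ c, (za c i : ℝ) * u (.inl c) := fun i =>
      Finset.sum_congr rfl fun c _ => by rw [← hza]; ring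
    simp only [funext_iff, Option.forall, Matrix.mulVec, dotProduct, Fintype.sum_sum_type,
      Fintype.sum_option, Matrix.map_apply, e, hzl, hzy]
    simp [A, b, sub_eq_add_neg]
  let u : C ⊕ Option ι → ℝ := fun n => match n with
    | .inl c => α c
    | .inr none => D * y - D * ∑ c, α c * a c j
    | .inr (some i) => D * ∑ c, α c * a c i - D * l i
  obtain ⟨u', hu0, hu', hcard, hsize⟩ := exists_small_nonneg_solution A b β
    (by
      rintro (_ | _ | i) (c | _ | i')
      · simpa [A] using hβ
      · simp [A]
      · simp [A]
      · exact hzaβ _ _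
      · simpa [A] using hβ
      · simp [A]
      · exact hzaβ _ _
      · simp [A]
      · simp only [A]
        split_ifs
        · simpa using hβ
        · simp)
    (by
      rintro (_ | _ | i)
      · simpa [b] using hβ
      · exact hzyβ
      · exact hzlβ i)
    u
    (by
      rintro (c | _ | i)
      · exact h0 c
      · exact sub_nonneg.2 (by gcongr)
      · exact sub_nonneg.2 (mul_le_mul_of_nonneg_left (hlα i) hD'.le))
    ((hrow u).2 ⟨h1, by simp [u, Finset.mul_sum], fun i => by simp [u, Finset.mul_sum]⟩)
  obtain ⟨hs, hup, hlow⟩ := (hrow u').1 hu'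
  have hM : Fintype.card (Option (Option ι)) = Fintype.card ι + 2 := by simp
  rw [hM] at hcard hsize
  refine ⟨fun c => u' (.inl c), fun c => hu0 _, hs, fun i => ?_, ?_, ?_, fun c hc => hsize _ hc⟩
  · refine le_of_mul_le_mul_left ?_ hD'
    rw [← hlow i, Finset.mul_sum]
    linarith [hu0 (.inr (some i))]
  · refine le_of_mul_le_mul_left ?_ hD'
    rw [← hup, Finset.mul_sum]
    linarith [hu0 (.inr none)]
  · refine le_trans (Nat.card_le_card_of_injective (fun c : {c // u' (.inl c) ≠ 0} =>
      (⟨.inl c.1, c.2⟩ : {n // u' n ≠ 0})) fun c c' h => ?_) hcard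
    simpa [Subtype.ext_iff] using h

/-! ### Encoding sizes and common denominators -/

theorem le_two_pow_ratSize (q : ℚ) : q.den ≤ 2 ^ ratSize q ∧ |(q : ℝ)| ≤ 2 ^ ratSize q := by
  have h1 := (Nat.le_pow_clog one_lt_two (q.den + 1)).trans
    (Nat.pow_le_pow_right (n := 2) (by norm_num) (show _ ≤ ratSize q by unfold ratSize; omega))
  have h2 := (Nat.le_pow_clog one_lt_two (q.num.natAbs + 1)).trans
    (Nat.pow_le_pow_right (n := 2) (by norm_num) (show _ ≤ ratSize q by unfold ratSize; omega))
  refine ⟨by omega, ?_⟩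
  have h3 : (1 : ℝ) ≤ q.den := by exact_mod_cast q.pos
  have h4 : |(q.num : ℝ)| ≤ 2 ^ ratSize q := by
    have : |q.num| ≤ 2 ^ ratSize q := by
      zify at h2
      omega
    exact_mod_cast this
  rw [Rat.cast_def, abs_div, abs_of_pos (by linarith : (0 : ℝ) < q.den)]
  exact (div_le_self (abs_nonneg _) h3).trans h4

theorem exists_rat_of_realSize_ne_top {x : ℝ} (hx : realSize x ≠ ⊤) : ∃ q : ℚ, (q : ℝ) = x := by
  by_contra! h
  exact hx (by simp [realSize, h])

/-- The product of all the denominators works: sizes add up in a tuple, so it is at most two to the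
power of the total size. -/
theorem exists_common_den {Δ : Type*} [Fintype Δ] (q : Δ → ℚ) (s : Δ → ℕ∞) {n : ℕ}
    (h : tupleSize s ≤ n)
    (hs : ∀ d, ∀ t : ℕ, s d = t → (q d).den ≤ 2 ^ t ∧ |(q d : ℝ)| ≤ 2 ^ t) :
    ∃ Q : ℕ, 0 < Q ∧ Q ≤ 2 ^ n ∧ ∀ d, (q d).den ∣ Q ∧ |(q d : ℝ)| ≤ 2 ^ n := by
  have hsum : ∑ d, s d ≤ n := le_trans le_add_self h
  have hfin : ∀ d, ∃ t : ℕ, s d = t := fun d => by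
    have h1 : s d ≤ n := (Finset.single_le_sum (fun _ _ => zero_le) (Finset.mem_univ d)).trans hsum
    exact ⟨(s d).toNat, (ENat.natCast_toNat (ne_top_of_le_ne_top (ENat.natCast_ne_top n) h1)).symm⟩
  choose t ht using hfin
  have hsum' : ∑ d, t d ≤ n := by
    simp only [ht] at hsum
    exact_mod_cast hsum
  refine ⟨∏ d, (q d).den, Finset.prod_pos fun d _ => (q d).pos, ?_, fun d =>
    ⟨Finset.dvd_prod_of_mem _ (Finset.mem_univ d), (hs d _ (ht d)).2.trans ?_⟩⟩
  · calc ∏ d, (q d).den ≤ ∏ d, 2 ^ t d := Finset.prod_le_prod' fun d _ => (hs d _ (ht d)).1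
      _ = 2 ^ ∑ d, t d := Finset.prod_pow_eq_pow_sum _ _ _
      _ ≤ 2 ^ n := Nat.pow_le_pow_right (by norm_num) hsum'
  · exact pow_le_pow_right₀ (by norm_num)
      ((Finset.single_le_sum (fun _ _ => Nat.zero_le _) (Finset.mem_univ d)).trans hsum')

theorem exists_common_den_of_realSize {Δ : Type*} [Fintype Δ] (x : Δ → ℝ) {n : ℕ}
    (h : tupleSize (fun d => realSize (x d)) ≤ n) :
    ∃ Q : ℕ, 0 < Q ∧ Q ≤ 2 ^ n ∧ ∀ d, ∃ q : ℚ, (q : ℝ) = x d ∧ q.den ∣ Q ∧ |x d| ≤ 2 ^ n := by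
  have hq : ∀ d, ∃ q : ℚ, (q : ℝ) = x d := fun d => by
    refine exists_rat_of_realSize_ne_top (ne_top_of_le_ne_top (ENat.natCast_ne_top n) ?_)
    exact (Finset.single_le_sum (f := fun d => realSize (x d)) (fun _ _ => zero_le)
      (Finset.mem_univ d)).trans (le_trans le_add_self h)
  choose q hq using hq
  obtain ⟨Q, h0, hQ, hd⟩ := exists_common_den q _ h fun d t ht => by
    rw [← hq, realSize_ratCast] at ht
    have ht' : ratSize (q d) = t := by exact_mod_cast ht
    exact ht' ▸ le_two_pow_ratSize (q d)
  exact ⟨Q, h0, hQ, fun d => ⟨q d, hq d, (hd d).1, hq d ▸ (hd d).2⟩⟩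

theorem exists_common_den_of_erealSize {Δ : Type*} [Fintype Δ] (x : Δ → EReal) {n : ℕ}
    (h : tupleSize (fun d => erealSize (x d)) ≤ n) :
    ∃ Q : ℕ, 0 < Q ∧ Q ≤ 2 ^ n ∧ ∀ d, ∀ t : ℝ, x d = t →
      ∃ q : ℚ, (q : ℝ) = t ∧ q.den ∣ Q ∧ |t| ≤ 2 ^ n := by
  have hq : ∀ d, ∃ q : ℚ, (∀ t : ℝ, x d = t → (q : ℝ) = t) ∧
      ∀ t : ℕ, erealSize (x d) = t → q.den ≤ 2 ^ t ∧ |(q : ℝ)| ≤ 2 ^ t := by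
    intro d
    by_cases hd : x d = ⊤ ∨ x d = ⊥
    -- An infinite entry gets the dummy value `0`, whose denominator `1` does not affect the
    -- product.
    · refine ⟨0, fun t ht => ?_, fun t _ => ⟨?_, by simp⟩⟩
      · rcases hd with hd | hd <;> simp [hd] at ht
      · simpa using Nat.one_le_two_pow
    · have he : erealSize (x d) = realSize (x d).toReal := if_neg hd
      push Not at hd
      obtain ⟨q, hq⟩ : ∃ q : ℚ, (q : ℝ) = (x d).toReal := by
        refine exists_rat_of_realSize_ne_top (he ▸ ne_top_of_le_ne_top (ENat.natCast_ne_top n) ?_)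
        exact (Finset.single_le_sum (f := fun d => erealSize (x d)) (fun _ _ => zero_le)
          (Finset.mem_univ d)).trans (le_trans le_add_self h)
      refine ⟨q, fun t ht => by rw [hq, ht, EReal.toReal_coe], fun t ht => ?_⟩
      rw [he, ← hq, realSize_ratCast] at ht
      have ht' : ratSize q = t := by exact_mod_cast ht
      exact ht' ▸ le_two_pow_ratSize q
  choose q hq hq' using hq
  obtain ⟨Q, h0, hQ, hd⟩ := exists_common_den q _ h hq'
  exact ⟨Q, h0, hQ, fun d t ht => ⟨q d, hq d t ht, (hd d).1, hq d t ht ▸ (hd d).2⟩⟩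

theorem exists_int_eq_mul_of_den_dvd {q : ℚ} {D : ℕ} (h : q.den ∣ D) :
    ∃ z : ℤ, (D : ℝ) * q = z := by
  obtain ⟨k, rfl⟩ := h
  refine ⟨k * q.num, ?_⟩
  have : (q.den : ℝ) ≠ 0 := by exact_mod_cast q.den_nz
  rw [Rat.cast_def]
  push_cast
  field_simp

theorem exists_int_eq_mul_of_dvd {t : ℝ} {D D' : ℕ} (h : D ∣ D') (ht : ∃ z : ℤ, (D : ℝ) * t = z) :
    ∃ z : ℤ, (D' : ℝ) * t = z := by
  obtain ⟨k, rfl⟩ := h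
  obtain ⟨z, hz⟩ := ht
  exact ⟨k * z, by push_cast; rw [← hz]; ring⟩

/-! ### Certificates of polynomial size -/

namespace MeanPayoffGame

variable {ι V : Type*} {G : MeanPayoffGame ι V}

/-- A simple cycle has length at most `card V`, so the factorial clears the division by its length.
A single multiplier serves all the cycles and still has polynomially many bits. -/
theorem exists_int_eq_mul_cycleMP [Fintype V] {W : Set V} {Q : ℕ}
    (hQ : ∀ i, ∀ e ∈ G.E, (G.r i e.1 e.2).den ∣ Q) (c : G.SimpleCycle W) (i : ι) :
    ∃ z : ℤ, (((Fintype.card V).factorial * Q : ℕ) : ℝ) * G.cycleMP c i = z := by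
  have hz : ∀ k, ∃ z : ℤ, (Q : ℝ) * G.r i (c.2.1 k) (c.2.1 (k + 1)) = z := fun k =>
    exists_int_eq_mul_of_den_dvd (hQ i _ (c.2.2.2.2 k))
  choose z hz using hz
  obtain ⟨m, hm⟩ : (c.1 : ℕ) + 1 ∣ (Fintype.card V).factorial :=
    Nat.dvd_factorial (by omega) c.1.2
  refine ⟨m * ∑ k, z k, ?_⟩
  rw [hm, cycleMP]
  push_cast
  simp only [← hz, ← Finset.mul_sum]
  have : ((c.1 : ℕ) : ℝ) + 1 ≠ 0 := by positivity
  field_simp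

theorem abs_cycleMP_le [Fintype V] {W : Set V} {R : ℝ}
    (hR : ∀ i, ∀ e ∈ G.E, |(G.r i e.1 e.2 : ℝ)| ≤ R) (c : G.SimpleCycle W) (i : ι) :
    |G.cycleMP c i| ≤ R := by
  unfold cycleMP
  have h : (0 : ℝ) < (((c.1 : ℕ) + 1 : ℕ) : ℝ) := by positivity
  rw [abs_div, abs_of_pos h, div_le_iff₀ h]
  refine (Finset.abs_sum_le_sum_abs _ _).trans ?_
  refine (Finset.sum_le_card_nsmul _ _ R fun k _ => hR i _ (c.2.2.2.2 k)).trans_eq ?_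
  simp [mul_comm]

end MeanPayoffGame

theorem exists_int_abs_le {t : ℝ} {D S T : ℕ} (h : ∃ z : ℤ, (D : ℝ) * t = z) (hD : D ≤ 2 ^ T)
    (ht : |t| ≤ 2 ^ S) : ∃ z : ℤ, (D : ℝ) * t = z ∧ |z| ≤ 2 ^ (T + S) := by
  obtain ⟨z, hz⟩ := h
  refine ⟨z, hz, ?_⟩
  have h1 : |(z : ℝ)| ≤ 2 ^ (T + S) := by
    rw [← hz, abs_mul, pow_add, abs_of_nonneg (by positivity)]
    have : (D : ℝ) ≤ 2 ^ T := by exact_mod_cast hD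
    gcongr
  exact_mod_cast h1

theorem sparseSize_le {Δ : Type*} [Fintype Δ] {f : Δ → ℝ} {k b : ℕ}
    (hk : Nat.card {d // f d ≠ 0} ≤ k) (hb : ∀ d, f d ≠ 0 → realSize (f d) ≤ b) :
    sparseSize f ≤ ((k * (1 + b) : ℕ) : ℕ∞) := by
  classical
  rw [Nat.card_eq_fintype_card] at hk
  have h := Finset.sum_le_card_nsmul (Finset.univ : Finset {d // f d ≠ 0})
    (fun d => realSize (f d)) b fun d _ => hb d d.2
  unfold sparseSize tupleSize
  have h2 : ((Fintype.card {d // f d ≠ 0} : ℕ) : ℕ∞) + Fintype.card {d // f d ≠ 0} • (b : ℕ∞) ≤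
      ((k * (1 + b) : ℕ) : ℕ∞) := by
    rw [nsmul_eq_mul]
    norm_cast
    calc _ = Fintype.card {d // f d ≠ 0} * (1 + b) := by ring
      _ ≤ _ := Nat.mul_le_mul_right _ hk
  refine le_trans ?_ h2
  convert add_le_add_right h _ using 1
  rw [Finset.card_univ]

theorem card_uncurry_support_le {ι C : Type*} [Fintype ι] [Finite C] {α : ι → C → ℝ} {k : ℕ}
    (h : ∀ j, Nat.card {c // α j c ≠ 0} ≤ k) :
    Nat.card {d : ι × C // α d.1 d.2 ≠ 0} ≤ Fintype.card ι * k := by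
  have e : {d : ι × C // α d.1 d.2 ≠ 0} ≃ Σ j, {c // α j c ≠ 0} :=
    ⟨fun d => ⟨d.1.1, d.1.2, d.2⟩, fun d => ⟨(d.1, d.2.1), d.2.2⟩, fun _ => rfl, fun _ => rfl⟩
  rw [Nat.card_congr e, Nat.card_sigma]
  simpa using Finset.sum_le_card_nsmul Finset.univ _ k fun j _ => h j

/-- Take the maximum of `x i` and of the requirements on the states of `W'` owned by `i`. Unlike `z
i`, which will be a payoff, it is an entry of the input, so its size is controlled. -/
theorem exists_real_lowerBound {ι V : Type*} [Finite V] (owner : V → ι) {x z : ι → ℝ}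
    {lam : V → EReal} {W' : Set V} (hx : x ≤ z)
    (hlam : ∀ v ∈ W', lam v ≤ ((z (owner v) : ℝ) : EReal)) (i : ι) :
    ∃ t : ℝ, (t = x i ∨ ∃ v, lam v = t) ∧ x i ≤ t ∧
      (∀ v ∈ W', owner v = i → lam v ≤ (t : EReal)) ∧ t ≤ z i := by
  obtain ⟨v, hv, hmax⟩ := Set.exists_max_image
    (insert ((x i : ℝ) : EReal) (lam '' {v | v ∈ W' ∧ owner v = i})) id
    (Set.toFinite _) (Set.insert_nonempty _ _)
  have hvz : v ≤ ((z i : ℝ) : EReal) := by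
    rcases hv with rfl | ⟨v, ⟨hvW, rfl⟩, rfl⟩
    · exact EReal.coe_le_coe (hx i)
    · exact hlam v hvW
  have hxv : ((x i : ℝ) : EReal) ≤ v := hmax _ (Set.mem_insert _ _)
  lift v to ℝ using ⟨ne_top_of_le_ne_top (EReal.coe_ne_top _) hvz,
    ne_bot_of_le_ne_bot (EReal.coe_ne_bot _) hxv⟩
  refine ⟨v, ?_, EReal.coe_le_coe_iff.1 hxv, fun w hw hwi =>
    hmax _ (Set.mem_insert_of_mem _ ⟨w, ⟨hw, hwi⟩, rfl⟩), EReal.coe_le_coe_iff.1 hvz⟩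
  rcases hv with h | ⟨w, _, h⟩
  · exact Or.inl (EReal.coe_injective h)
  · exact Or.inr ⟨w, h⟩

namespace MeanPayoffGame

variable {ι V : Type*} {G : MeanPayoffGame ι V}

/-- The lower bounds `l` are common to all `j`, hence pass to the minimum over `j`; for the upper
bound on that minimum, the inequality for player `j` under its own coefficients suffices. The
systems are therefore solved independently. -/
theorem exists_small_coeffs [Fintype ι] [Fintype V] {W W' : Set V} {x y z : ι → ℝ}
    {lam : V → EReal} {S : ℕ} (hS : instanceSize G x y lam = S) (hx : x ≤ z) (hy : z ≤ y)
    (hlam : ∀ v ∈ W', lam v ≤ ((z (G.owner v) : ℝ) : EReal))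
    (α : ι → G.SimpleCycle W → ℝ) (h0 : ∀ j c, 0 ≤ α j c) (h1 : ∀ j, ∑ c, α j c = 1)
    (hle : ∀ j i, z i ≤ ∑ c, α j c * G.cycleMP c i)
    (hge : ∀ j, ∑ c, α j c * G.cycleMP c j ≤ z j) :
    ∃ (α' : ι → G.SimpleCycle W → ℝ) (l : ι → ℝ), (∀ j c, 0 ≤ α' j c) ∧ (∀ j, ∑ c, α' j c = 1) ∧
      x ≤ l ∧ (∀ i, ∀ v ∈ W', G.owner v = i → lam v ≤ ((l i : ℝ) : EReal)) ∧
      (∀ j i, l i ≤ ∑ c, α' j c * G.cycleMP c i) ∧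
      (∀ j, ∑ c, α' j c * G.cycleMP c j ≤ y j) ∧
      sparseSize (fun d : ι × G.SimpleCycle W => α' d.1 d.2) ≤
        ((S * (S + 2) * (1 + (1 + 2 * (2 * (S + 2) ^ 2 + 2 * (S * S + 5 * S) * (S + 2) + 1))) : ℕ)
          : ℕ∞) := by
  classical
  have hS' : G.size + tupleSize (fun i => realSize (x i)) + tupleSize (fun i => realSize (y i)) +
    tupleSize (fun v => erealSize (lam v)) = S := hS
  obtain ⟨Ql, hl0, hlS, hl⟩ := exists_common_den_of_erealSize lam (hS' ▸ le_add_self)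
  obtain ⟨Qy, hy0, hyS, hy'⟩ := exists_common_den_of_realSize y
    (hS' ▸ le_add_self.trans le_self_add)
  obtain ⟨Qx, hx0, hxS, hx'⟩ := exists_common_den_of_realSize x
    (hS' ▸ le_add_self.trans (le_self_add.trans le_self_add))
  have hGS : G.size ≤ S := hS' ▸ le_self_add.trans (le_self_add.trans le_self_add)
  unfold MeanPayoffGame.size at hGS
  obtain ⟨Qr, hr0, hrS, hr⟩ := exists_common_den
    (fun d : ι × G.E => G.r d.1 d.2.1.1 d.2.1.2) _ (le_add_self.trans hGS) fun d t ht => by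
      have ht' : ratSize (G.r d.1 d.2.1.1 d.2.1.2) = t := by exact_mod_cast ht
      exact ht' ▸ le_two_pow_ratSize _
  have hιV : Fintype.card ι + Fintype.card V ≤ S := by
    exact_mod_cast le_self_add.trans (le_self_add.trans hGS)
  have hr1 : ∀ i, ∀ e ∈ G.E, (G.r i e.1 e.2).den ∣ Qr := fun i e he => (hr (i, ⟨e, he⟩)).1
  have hr2 : ∀ i, ∀ e ∈ G.E, |(G.r i e.1 e.2 : ℝ)| ≤ 2 ^ S := fun i e he => (hr (i, ⟨e, he⟩)).2
  have hfac : (Fintype.card V).factorial ≤ 2 ^ (S * S) := by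
    calc _ ≤ S.factorial := Nat.factorial_le (by omega)
      _ ≤ S ^ S := Nat.factorial_le_pow S
      _ ≤ (2 ^ S) ^ S := Nat.pow_le_pow_left Nat.lt_two_pow_self.le S
      _ = _ := (pow_mul _ _ _).symm
  -- The factorial takes `S * S` bits and each common denominator `S` bits; the numbers to be scaled
  -- have absolute value at most `2 ^ S`, which gives `S * S + 5 * S` bits for the integer data.
  set D := (Fintype.card V).factorial * Qr * (Qx * Qy * Ql) with hD
  have hD0 : 0 < D := by positivity
  have hDS : D ≤ 2 ^ (S * S + 4 * S) := by
    calc D ≤ 2 ^ (S * S) * 2 ^ S * (2 ^ S * 2 ^ S * 2 ^ S) := by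
          rw [hD]; gcongr
      _ = _ := by ring
  have hxD : Qx ∣ D := ⟨(Fintype.card V).factorial * Qr * (Qy * Ql), by rw [hD]; ring⟩
  have hyD : Qy ∣ D := ⟨(Fintype.card V).factorial * Qr * (Qx * Ql), by rw [hD]; ring⟩
  have hlD : Ql ∣ D := ⟨(Fintype.card V).factorial * Qr * (Qx * Qy), by rw [hD]; ring⟩
  have hrD : (Fintype.card V).factorial * Qr ∣ D := ⟨_, hD⟩
  have hrat : ∀ (t : ℝ) (Q : ℕ), Q ∣ D → (∃ q : ℚ, (q : ℝ) = t ∧ q.den ∣ Q ∧ |t| ≤ 2 ^ S) →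
      ∃ w : ℤ, (D : ℝ) * t = w ∧ |w| ≤ 2 ^ (S * S + 4 * S + S) := by
    rintro t Q hQ ⟨q, rfl, hq, hb⟩
    exact exists_int_abs_le (exists_int_eq_mul_of_den_dvd (hq.trans hQ)) hDS hb
  choose l hl1 hxl hll hlz using exists_real_lowerBound G.owner hx hlam
  have key := fun j => exists_small_coeff (fun c : G.SimpleCycle W => G.cycleMP c) l (y j) j D
    (S * S + 4 * S + S)
    (fun c i => exists_int_abs_le
      (exists_int_eq_mul_of_dvd hrD (exists_int_eq_mul_cycleMP hr1 c i)) hDS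
      (abs_cycleMP_le hr2 c i))
    (fun i => by
      rcases hl1 i with h | ⟨v, h⟩
      · exact h ▸ hrat _ _ hxD (hx' i)
      · exact hrat _ _ hlD (hl v _ h))
    (hrat _ _ hyD (hy' j)) hD0 (α j) (h0 j) (h1 j) (fun i => (hlz i).trans (hle j i))
    ((hge j).trans (hy j))
  choose α' h0' h1' hle' hge' hcard hsize using key
  refine ⟨α', l, h0', h1', hxl, hll, hle', hge', ?_⟩
  have hι : Fintype.card ι ≤ S := by omega
  refine sparseSize_le ?_ fun d hd => (hsize d.1 d.2 hd).trans ?_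
  · refine (card_uncurry_support_le hcard).trans ?_
    gcongr
  · have e : S * S + 5 * S = S * S + 4 * S + S := by ring
    rw [e]
    norm_cast
    gcongr

theorem exists_certificate_of_play [Fintype ι] [Fintype V] {x y : ι → ℝ}
    {lam : V → EReal} {ρ : ℕ → V} (hρ : G.IsPlay ρ) (hlam : G.IsConsistent lam ρ)
    (hx : x ≤ G.payoff ρ) (hy : G.payoff ρ ≤ y) :
    ∃ (W W' : Set V) (α : ι → G.SimpleCycle W → ℝ),
      W ⊆ W' ∧ (∀ j c, α j c ∈ Set.Icc (0 : ℝ) 1) ∧ G.IsStronglyConnected W ∧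
      G.IsAccessibleVia (ρ 0) W W' ∧ (∀ i, ∑ c, α i c = 1) ∧
      (∀ i, x i ≤ G.combinedMP α i ∧ G.combinedMP α i ≤ y i) ∧
      (∀ i, ∀ v ∈ W', G.owner v = i → lam v ≤ ((G.combinedMP α i : ℝ) : EReal)) ∧
      ∀ S : ℕ, instanceSize G x y lam = S →
        sparseSize (fun d : ι × G.SimpleCycle W => α d.1 d.2) ≤
        ((S * (S + 2) * (1 + (1 + 2 * (2 * (S + 2) ^ 2 + 2 * (S * S + 5 * S) * (S + 2) + 1))) : ℕ)
          : ℕ∞) := by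
  obtain ⟨N, hN⟩ := exists_forall_ge_mem_infStates ρ
  have hlam' : ∀ v ∈ Set.range ρ, lam v ≤ ((G.payoff ρ (G.owner v) : ℝ) : EReal) := by
    rintro _ ⟨n, rfl⟩
    simpa [payoff_shift] using hlam _ n rfl
  choose α h0 h1 hle hge using exists_coeff_of_play (W := infStates ρ)
    (σ := fun k => ρ (N + k)) (fun n => hρ (N + n)) hN
  simp only [payoff_shift] at hle hge
  obtain ⟨α', l, h0', h1', hxl, hll, hle', hge', hsize⟩ :
      ∃ (α' : ι → G.SimpleCycle (infStates ρ) → ℝ) (l : ι → ℝ), (∀ j c, 0 ≤ α' j c) ∧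
        (∀ j, ∑ c, α' j c = 1) ∧ x ≤ l ∧
        (∀ i, ∀ v ∈ Set.range ρ, G.owner v = i → lam v ≤ ((l i : ℝ) : EReal)) ∧
        (∀ j i, l i ≤ ∑ c, α' j c * G.cycleMP c i) ∧
        (∀ j, ∑ c, α' j c * G.cycleMP c j ≤ y j) ∧
        ∀ S : ℕ, instanceSize G x y lam = S →
          sparseSize (fun d : ι × G.SimpleCycle (infStates ρ) => α' d.1 d.2) ≤
          ((S * (S + 2) *
            (1 + (1 + 2 * (2 * (S + 2) ^ 2 + 2 * (S * S + 5 * S) * (S + 2) + 1))) : ℕ) : ℕ∞) := by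
    -- For infinite size there is no bound to meet, and the limit frequencies themselves serve.
    by_cases hS : instanceSize G x y lam = ⊤
    · exact ⟨α, G.payoff ρ, h0, h1, hx, fun i v hv hi => hi ▸ hlam' v hv, hle,
        fun j => (hge j).trans (hy j), fun S h => by simp [hS] at h⟩
    · obtain ⟨S, hS'⟩ := ENat.ne_top_iff_exists.1 hS
      obtain ⟨α', l, h0', h1', hxl, hll, hle', hge', hsize⟩ :=
        exists_small_coeffs hS'.symm hx hy hlam' α h0 h1 hle hge
      refine ⟨α', l, h0', h1', hxl, hll, hle', hge', fun T hT => ?_⟩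
      obtain rfl : S = T := by exact_mod_cast hS'.trans hT
      exact hsize
  have hl : ∀ i, l i ≤ G.combinedMP α' i := fun i =>
    have : Nonempty ι := ⟨i⟩
    le_ciInf fun j => hle' j i
  have hu : ∀ i, G.combinedMP α' i ≤ y i := fun i =>
    (ciInf_le (Set.finite_range _).bddBelow i).trans (hge' i)
  refine ⟨infStates ρ, Set.range ρ, α', ?_, fun j c => ⟨h0' j c, ?_⟩,
    isStronglyConnected_infStates hρ, isAccessibleVia_infStates hρ, h1',
    fun i => ⟨(hxl i).trans (hl i), hu i⟩,
    fun i v hv hi => (hll i v hv hi).trans (EReal.coe_le_coe (hl i)), hsize⟩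
  · intro v hv
    obtain ⟨n, hn⟩ := Frequently.exists hv
    exact ⟨n, hn⟩
  · rw [← h1' j]
    exact Finset.single_le_sum (fun c _ => h0' j c) (Finset.mem_univ c)

end MeanPayoffGame

/-! ### Walks with recorded length and rewards -/

/-- There is a walk of length `n` from `u` to `v` along which player `i` collects `s i`. -/
def HasWalk {ι V : Type*} (R : V → V → Prop) (r : ι → V → V → ℝ) (u v : V) (n : ℕ)
    (s : ι → ℝ) : Prop :=
  ∃ f : ℕ → V, f 0 = u ∧ f n = v ∧ (∀ k < n, R (f k) (f (k + 1))) ∧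
    ∀ i, ∑ k ∈ Finset.range n, r i (f k) (f (k + 1)) = s i

namespace HasWalk

variable {ι V : Type*} {R : V → V → Prop} {r : ι → V → V → ℝ} {u v w : V} {n m : ℕ} {s t : ι → ℝ}

theorem refl (u : V) : HasWalk R r u u 0 0 := ⟨fun _ => u, rfl, rfl, by simp, by simp⟩

theorem single (h : R u v) : HasWalk R r u v 1 (fun i => r i u v) :=
  ⟨fun k => if k = 0 then u else v, by simp, by simp, by simpa using h, by simp⟩

theorem trans (h₁ : HasWalk R r u v n s) (h₂ : HasWalk R r v w m t) :
    HasWalk R r u w (n + m) (s + t) := by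
  obtain ⟨f, hf0, hfn, hfR, hfs⟩ := h₁
  obtain ⟨g, hg0, hgm, hgR, hgt⟩ := h₂
  let h : ℕ → V := fun k => if k < n then f k else g (k - n)
  have hle : ∀ k ≤ n, h k = f k := by
    intro k hk
    rcases hk.lt_or_eq with hk | rfl
    · simp [h, hk]
    · simp [h, hg0, hfn]
  have hge : ∀ k, h (n + k) = g k := fun k => by simp [h]
  refine ⟨h, by rw [hle 0 (Nat.zero_le _), hf0], by rw [hge, hgm], fun k hk => ?_, fun i => ?_⟩
  · rcases lt_or_ge k n with hkn | hkn
    · rw [hle k hkn.le, hle (k + 1) hkn]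
      exact hfR k hkn
    · obtain ⟨k, rfl⟩ := Nat.exists_eq_add_of_le hkn
      rw [hge, add_assoc, hge]
      exact hgR k (by omega)
  · rw [Finset.sum_range_add, Pi.add_apply, ← hfs, ← hgt]
    congr 1
    · refine Finset.sum_congr rfl fun k hk => ?_
      have hk := Finset.mem_range.1 hk
      rw [hle k hk.le, hle (k + 1) hk]
    · refine Finset.sum_congr rfl fun k _ => ?_
      rw [hge, add_assoc, hge]

theorem nsmul (h : HasWalk R r u u n s) (m : ℕ) : HasWalk R r u u (m * n) (m • s) := by
  induction m with
  | zero => simpa using refl u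
  | succ m ih => simpa [add_mul, add_smul] using ih.trans h

theorem of_reflTransGen (h : Relation.ReflTransGen R u v) : ∃ n s, HasWalk R r u v n s := by
  induction h with
  | refl => exact ⟨0, 0, refl u⟩
  | tail _ h ih =>
    obtain ⟨n, s, hw⟩ := ih
    exact ⟨_, _, hw.trans (single h)⟩

/-- Here `t₀` and `s₀` are the fixed cost of the detour from `u` to the cycle `c` and back,
independent of the number `m c` of turns. -/
theorem sum {C : Type*} (F : Finset C) (len : C → ℕ) (rew : C → ι → ℝ) (t₀ : C → ℕ)
    (s₀ : C → ι → ℝ)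
    (h : ∀ c, ∀ m : ℕ, HasWalk R r u u (m * len c + t₀ c) (m • rew c + s₀ c)) (m : C → ℕ) :
    HasWalk R r u u (∑ c ∈ F, (m c * len c + t₀ c)) (∑ c ∈ F, (m c • rew c + s₀ c)) := by
  classical
  induction F using Finset.induction_on with
  | empty => simpa using refl u
  | insert c F hc ih =>
    rw [Finset.sum_insert hc, Finset.sum_insert hc]
    exact (h c (m c)).trans ih

/-- Walks that fit together can be concatenated to an infinite one. -/
theorem exists_concat {a : ℕ → V} {n : ℕ → ℕ} {s : ℕ → ι → ℝ} (hn : ∀ k, 1 ≤ n k)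
    (h : ∀ k, HasWalk R r (a k) (a (k + 1)) (n k) (s k)) :
    ∃ ρ : ℕ → V, ρ 0 = a 0 ∧ (∀ m, R (ρ m) (ρ (m + 1))) ∧
      ∀ K i, ∑ m ∈ Finset.range (∑ k ∈ Finset.range K, n k), r i (ρ m) (ρ (m + 1)) =
        ∑ k ∈ Finset.range K, s k i := by
  choose f hf0 hfn hfR hfs using h
  -- A pair holds the current block and the position in it. Position `n k` of block `k` is
  -- identified with position `0` of the next block, where the walks agree.
  let step : ℕ × ℕ → ℕ × ℕ := fun q => if q.2 + 1 < n q.1 then (q.1, q.2 + 1) else (q.1 + 1, 0)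
  let st : ℕ → ℕ × ℕ := fun m => step^[m] (0, 0)
  have hst : ∀ m, st (m + 1) = step (st m) := fun m => Function.iterate_succ_apply' _ _ _
  have hinv : ∀ m, (st m).2 < n (st m).1 := by
    intro m
    induction m with
    | zero => exact hn 0
    | succ m ih =>
      rw [hst]
      by_cases hc : (st m).2 + 1 < n (st m).1
      · simp only [step, if_pos hc]; exact hc
      · simp only [step, if_neg hc]; exact hn _
  let ρ : ℕ → V := fun m => f (st m).1 (st m).2
  have hnext : ∀ m, ρ (m + 1) = f (st m).1 ((st m).2 + 1) := by
    intro m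
    simp only [ρ, hst]
    by_cases hc : (st m).2 + 1 < n (st m).1
    · simp only [step, if_pos hc]
    · have e : (st m).2 + 1 = n (st m).1 := by have := hinv m; omega
      simp only [step, if_neg hc, hf0]
      rw [e, hfn]
  have hblock : ∀ T k, st T = (k, 0) → ∀ l < n k, st (T + l) = (k, l) := by
    intro T k hT l hl
    induction l with
    | zero => simpa using hT
    | succ l ih =>
      rw [← add_assoc, hst, ih (by omega)]
      simp [step, hl]
  have hstart : ∀ K, st (∑ k ∈ Finset.range K, n k) = (K, 0) := by
    intro K
    induction K with
    | zero => rfl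
    | succ K ih =>
      obtain ⟨l, hl⟩ := Nat.exists_eq_add_of_le (hn K)
      rw [Finset.sum_range_succ, hl, add_comm 1 l, ← add_assoc, hst, hblock _ _ ih l (by omega)]
      simp [step, hl, add_comm 1 l]
  refine ⟨ρ, hf0 0, fun m => ?_, fun K i => ?_⟩
  · rw [hnext]
    exact hfR _ _ (hinv m)
  · induction K with
    | zero => simp
    | succ K ih =>
      rw [Finset.sum_range_succ, Finset.sum_range_add, ih, Finset.sum_range_succ, ← hfs]
      congr 1
      refine Finset.sum_congr rfl fun l hl => ?_
      rw [add_assoc, ← add_assoc _ l 1, hnext]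
      simp only [ρ, hblock _ _ (hstart K) l (Finset.mem_range.1 hl)]

end HasWalk

/-- A sequence that takes every value constantly on arbitrarily late intervals `[a, a ^ 2)`. -/
theorem exists_seq_const_on_long_blocks (ι : Type*) [Countable ι] [Nonempty ι] :
    ∃ f : ℕ → ι, ∀ i M, ∃ a ≥ M, ∀ k, a ≤ k → k < a ^ 2 → f k = i := by
  obtain ⟨g, hg⟩ := exists_surjective_nat ι
  -- The iterated logarithm equals `t` exactly on `[a, a ^ 2)` with `a = 2 ^ 2 ^ t`; pairing with
  -- `M` makes each value recur arbitrarily late.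
  refine ⟨fun k => g (Nat.unpair (Nat.log 2 (Nat.log 2 k))).1, fun i M => ?_⟩
  obtain ⟨e, rfl⟩ := hg i
  set t := Nat.pair e M
  refine ⟨2 ^ 2 ^ t, ?_, fun k h1 h2 => ?_⟩
  · exact (Nat.right_le_pair e M).trans
      (Nat.lt_two_pow_self.le.trans Nat.lt_two_pow_self.le)
  · rw [← pow_mul, ← pow_succ] at h2
    have hk : k ≠ 0 := by
      have : 0 < 2 ^ 2 ^ t := by positivity
      omega
    have h3 : 2 ^ t ≤ Nat.log 2 k := (Nat.le_log_iff_pow_le one_lt_two hk).2 h1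
    have h4 : Nat.log 2 k < 2 ^ (t + 1) := (Nat.log_lt_iff_lt_pow one_lt_two hk).2 h2
    have h5 : Nat.log 2 (Nat.log 2 k) = t := Nat.log_eq_of_pow_le_of_lt_pow h3 h4
    simp [h5, t]

/-! ### Closed walks with prescribed cycle frequencies -/

namespace MeanPayoffGame

variable {ι V : Type*} {G : MeanPayoffGame ι V}

theorem hasWalk_simpleCycle [Fintype V] {W : Set V} (c : G.SimpleCycle W) :
    HasWalk (fun u v => u ∈ W ∧ v ∈ W ∧ (u, v) ∈ G.E) (fun i u v => (G.r i u v : ℝ))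
      (c.2.1 0) (c.2.1 0) ((c.1 : ℕ) + 1) (((c.1 : ℕ) + 1) • G.cycleMP c) := by
  have hs : ∀ k, Fin.ofNat ((c.1 : ℕ) + 1) (k + 1) = Fin.ofNat ((c.1 : ℕ) + 1) k + 1 := by
    intro k
    ext
    simp [Fin.val_add]
  refine ⟨fun k => c.2.1 (Fin.ofNat _ k), by simp, by simp, fun k _ => ?_, fun i => ?_⟩
  · simp only [hs]
    exact ⟨c.2.2.2.1 _, c.2.2.2.1 _, c.2.2.2.2 _⟩
  · simp only [hs, Finset.sum_range, Fin.ofNat_val_eq_self, Pi.smul_apply, cycleMP, nsmul_eq_mul]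
    rw [mul_div_cancel₀]
    positivity

/-- Strong connectedness lets one walk visit every cycle from `w`, turning on each for its share of
the time. Detours and rounding cost a constant, and the point is that `B` depends neither on `α` nor
on `k`. -/
theorem exists_closed_walk_near [Fintype ι] [Fintype V] {W : Set V}
    (hW : G.IsStronglyConnected W) {w : V} (hw : w ∈ W) :
    ∃ B : ℝ, 0 ≤ B ∧ ∀ α : G.SimpleCycle W → ℝ, (∀ c, 0 ≤ α c) → ∑ c, α c = 1 → ∀ k : ℕ,
      ∃ (n : ℕ) (s : ι → ℝ), 1 ≤ n ∧
        HasWalk (fun u v => u ∈ W ∧ v ∈ W ∧ (u, v) ∈ G.E) (fun i u v => (G.r i u v : ℝ)) w w n s ∧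
        |(n : ℝ) - k| ≤ B ∧ ∀ i, |s i - k * ∑ c, α c * G.cycleMP c i| ≤ B := by
  classical
  obtain ⟨R, hR0, hR⟩ := G.exists_abs_reward_le
  have hloop : ∀ c : G.SimpleCycle W, ∃ (t : ℕ) (s : ι → ℝ), ∀ m : ℕ,
      HasWalk (fun u v => u ∈ W ∧ v ∈ W ∧ (u, v) ∈ G.E) (fun i u v => (G.r i u v : ℝ)) w w
        (m * ((c.1 : ℕ) + 1) + t) (m • (((c.1 : ℕ) + 1) • G.cycleMP c) + s) := by
    intro c
    obtain ⟨n₁, s₁, h₁⟩ := HasWalk.of_reflTransGen (r := fun i u v => (G.r i u v : ℝ))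
      (hW w hw _ (c.2.2.2.1 0))
    obtain ⟨n₂, s₂, h₂⟩ := HasWalk.of_reflTransGen (r := fun i u v => (G.r i u v : ℝ))
      (hW _ (c.2.2.2.1 0) w hw)
    refine ⟨n₁ + n₂, s₁ + s₂, fun m => ?_⟩
    have := (h₁.trans ((hasWalk_simpleCycle c).nsmul m)).trans h₂
    convert this using 1
    · ring
    · abel
  choose t₀ s₀ hts using hloop
  have hall := HasWalk.sum Finset.univ (fun c : G.SimpleCycle W => (c.1 : ℕ) + 1) _ t₀ s₀ hts
  set X : ℝ := ∑ c : G.SimpleCycle W, (Fintype.card V : ℝ)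
  have hX : 0 ≤ X := Finset.sum_nonneg fun _ _ => by positivity
  have ht0 : (0 : ℝ) ≤ ∑ c, (t₀ c : ℝ) := Finset.sum_nonneg fun _ _ => by positivity
  have hs0 : ∀ i, |∑ c, s₀ c i| ≤ ∑ i, |∑ c, s₀ c i| := fun i =>
    Finset.single_le_sum (f := fun i => |∑ c, s₀ c i|) (fun _ _ => abs_nonneg _)
      (Finset.mem_univ i)
  have hs1 : 0 ≤ ∑ i, |∑ c, s₀ c i| := Finset.sum_nonneg fun _ _ => abs_nonneg _
  refine ⟨X + X * R + ∑ c, (t₀ c : ℝ) + ∑ i, |∑ c, s₀ c i|, by positivity,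
    fun α hα hα1 k => ?_⟩
  -- The extra turn keeps the walk nonempty even for `k = 0`; the rounding error stays within one
  -- turn, hence within `card V` transitions.
  let m : G.SimpleCycle W → ℕ := fun c => ⌊k * α c / (((c.1 : ℕ) : ℝ) + 1)⌋₊ + 1
  have hm : ∀ c, |(m c : ℝ) * (((c.1 : ℕ) : ℝ) + 1) - k * α c| ≤ Fintype.card V := by
    intro c
    have hl : (0 : ℝ) < ((c.1 : ℕ) : ℝ) + 1 := by positivity
    have hlV : ((c.1 : ℕ) : ℝ) + 1 ≤ Fintype.card V := by exact_mod_cast c.1.2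
    have h1 := Nat.floor_le (show 0 ≤ k * α c / (((c.1 : ℕ) : ℝ) + 1) by
      have := hα c; positivity)
    have h2 := Nat.lt_floor_add_one (k * α c / (((c.1 : ℕ) : ℝ) + 1))
    rw [le_div_iff₀ hl] at h1
    rw [div_lt_iff₀ hl] at h2
    have e : (m c : ℝ) = (⌊k * α c / (((c.1 : ℕ) : ℝ) + 1)⌋₊ : ℝ) + 1 := by simp [m]
    rw [e, abs_le]
    constructor <;> linarith
  obtain ⟨c₀⟩ : Nonempty (G.SimpleCycle W) := by
    by_contra h
    rw [not_nonempty_iff] at h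
    simp at hα1
  have hdiff : ∀ (f : G.SimpleCycle W → ℝ) (F : ℝ), 0 ≤ F → (∀ c, |f c| ≤ F) →
      |∑ c, (m c : ℝ) * (((c.1 : ℕ) : ℝ) + 1) * f c - k * ∑ c, α c * f c| ≤ X * F := by
    intro f F hF hf
    rw [Finset.mul_sum, ← Finset.sum_sub_distrib, Finset.sum_mul]
    refine (Finset.abs_sum_le_sum_abs _ _).trans (Finset.sum_le_sum fun c _ => ?_)
    rw [← mul_assoc, ← sub_mul, abs_mul]
    exact mul_le_mul (hm c) (hf c) (abs_nonneg _) (by positivity)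
  refine ⟨_, _, ?_, hall m, ?_, fun i => ?_⟩
  · refine le_trans ?_ (Finset.single_le_sum (fun _ _ => Nat.zero_le _) (Finset.mem_univ c₀))
    have : 1 ≤ m c₀ * ((c₀.1 : ℕ) + 1) := Nat.mul_pos (Nat.succ_pos _) (Nat.succ_pos _)
    omega
  · have h := hdiff 1 1 zero_le_one (by simp)
    simp only [Pi.one_apply, mul_one, hα1] at h
    push_cast
    rw [Finset.sum_add_distrib]
    rw [abs_le] at h ⊢
    have : 0 ≤ X * R := by positivity
    constructor <;> linarith
  · have h := hdiff (fun c => G.cycleMP c i) R hR0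
      (fun c => abs_cycleMP_le (fun i e _ => hR i e.1 e.2) c i)
    have e : (∑ c, (m c • (((c.1 : ℕ) + 1) • G.cycleMP c) + s₀ c)) i =
        ∑ c, (m c : ℝ) * (((c.1 : ℕ) : ℝ) + 1) * G.cycleMP c i + ∑ c, s₀ c i := by
      simp [Finset.sum_apply, Finset.sum_add_distrib, mul_assoc]
    rw [e]
    have h2 := hs0 i
    rw [abs_le] at h h2 ⊢
    constructor <;> linarith

end MeanPayoffGame

/-! ### Averages along blocks of linearly growing length -/

theorem sum_range_natCast_eq (K : ℕ) :
    ∑ k ∈ Finset.range K, (k : ℝ) = K * (K - 1) / 2 := by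
  induction K with
  | zero => simp
  | succ K ih => rw [Finset.sum_range_succ, ih]; push_cast; ring

theorem exists_forall_ge_mul_le_sum_range (C B : ℝ) {ε : ℝ} (hε : 0 < ε) :
    ∃ K₀ : ℕ, ∀ K ≥ K₀, C * ((K : ℝ) + 1) ≤ ε * (∑ k ∈ Finset.range K, (k : ℝ) - B * K) := by
  obtain ⟨K₀, hK₀⟩ := exists_nat_ge (1 + 2 * |B| + 4 * |C| / ε)
  refine ⟨K₀, fun K hK => ?_⟩
  have hK' : (1 : ℝ) + 2 * |B| + 4 * |C| / ε ≤ K := hK₀.trans (by exact_mod_cast hK)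
  have h1 : 0 ≤ 4 * |C| / ε := by positivity
  have h2 : (1 : ℝ) ≤ K := by linarith [abs_nonneg B]
  rw [sum_range_natCast_eq]
  have h3 : 2 * |C| ≤ ε * (((K : ℝ) - 1) / 2 - |B|) := by
    have : 4 * |C| / ε ≤ K - 1 - 2 * |B| := by linarith
    rw [div_le_iff₀ hε] at this
    linarith
  have h4 : C * ((K : ℝ) + 1) ≤ 2 * |C| * K := by
    have := mul_le_mul_of_nonneg_right (le_abs_self C) (show (0 : ℝ) ≤ K + 1 by linarith)
    nlinarith [abs_nonneg C]
  have h5 : ε * (((K : ℝ) - 1) / 2 - |B|) * K ≤ ε * (K * (K - 1) / 2 - B * K) := by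
    rw [mul_assoc]
    refine mul_le_mul_of_nonneg_left ?_ hε.le
    nlinarith [le_abs_self B]
  exact h4.trans ((mul_le_mul_of_nonneg_right h3 (by linarith)).trans h5)

theorem exists_sum_range_le_lt {n : ℕ → ℕ} (hn : ∀ k, 1 ≤ n k) (N : ℕ) :
    ∃ K, ∑ k ∈ Finset.range K, n k ≤ N ∧ N < ∑ k ∈ Finset.range (K + 1), n k := by
  induction N with
  | zero => exact ⟨0, by simp, by simpa using Nat.lt_of_lt_of_le one_pos (hn 0)⟩
  | succ N ih =>
    obtain ⟨K, h1, h2⟩ := ih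
    rcases Nat.lt_or_ge (N + 1) (∑ k ∈ Finset.range (K + 1), n k) with h | h
    · exact ⟨K, by omega, h⟩
    · refine ⟨K + 1, h, ?_⟩
      rw [Finset.sum_range_succ]
      have := hn (K + 1)
      omega

theorem abs_sum_range_sub_le {a b : ℕ → ℝ} {B : ℝ} (h : ∀ k, |a k - b k| ≤ B) (K : ℕ) :
    |∑ k ∈ Finset.range K, a k - ∑ k ∈ Finset.range K, b k| ≤ B * K := by
  rw [← Finset.sum_sub_distrib]
  refine (Finset.abs_sum_le_sum_abs _ _).trans ?_
  refine (Finset.sum_le_card_nsmul _ _ B fun k _ => h k).trans_eq ?_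
  simp [mul_comm]

namespace MeanPayoffGame

variable {ι V : Type*} {G : MeanPayoffGame ι V}

section Blocks

variable [Finite ι] [Finite V] {ρ : ℕ → V} {n : ℕ → ℕ} {s q : ℕ → ℝ} {B : ℝ} {i : ι}

/-- The first `K` blocks have total length of order `K ^ 2`, whereas the accumulated errors and the
unfinished block are `O(K)`, so both vanish in the average. -/
theorem le_payoff_of_blocks (hn : ∀ k, 1 ≤ n k) (hnB : ∀ k, |(n k : ℝ) - k| ≤ B)
    (hsB : ∀ k, |s k - k * q k| ≤ B)
    (hs : ∀ K, ∑ m ∈ Finset.range (∑ k ∈ Finset.range K, n k), (G.r i (ρ m) (ρ (m + 1)) : ℝ) =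
      ∑ k ∈ Finset.range K, s k) {x : ℝ} (hx : ∀ k, x ≤ q k) : x ≤ G.payoff ρ i := by
  obtain ⟨R, hR0, hR⟩ := G.exists_abs_reward_le
  have hB : 0 ≤ B := (abs_nonneg _).trans (hnB 0)
  refine le_payoff_iff.2 fun ε hε => ?_
  -- The three terms pay for the reward errors, the unfinished block, and the gap between `N` and
  -- the ideal length `0 + 1 + … + (K - 1)`.
  obtain ⟨K₀, hK₀⟩ := exists_forall_ge_mul_le_sum_range
    (B + R * (B + 1) + |x| * (2 * B + 1)) B hε
  refine eventually_atTop.2 ⟨∑ k ∈ Finset.range (K₀ + 1), n k, fun N hN => ?_⟩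
  obtain ⟨K, hK1, hK2⟩ := exists_sum_range_le_lt hn N
  have hKK : K₀ ≤ K := by
    by_contra h
    have := Finset.sum_le_sum_of_subset (f := n)
      (Finset.range_mono (show K + 1 ≤ K₀ + 1 by omega))
    omega
  have hNpos : (0 : ℝ) < N := by
    have : n 0 ≤ ∑ k ∈ Finset.range (K₀ + 1), n k :=
      Finset.single_le_sum (fun _ _ => Nat.zero_le _) (by simp)
    exact_mod_cast (by have := hn 0; omega)
  obtain ⟨b, rfl⟩ := Nat.exists_eq_add_of_le hK1
  rw [Finset.sum_range_succ] at hK2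
  have hb : (b : ℝ) ≤ K + B := by
    have h1 : (b : ℝ) ≤ n K := by exact_mod_cast (by omega)
    linarith [(abs_le.1 (hnB K)).2]
  have hT := abs_le.1 (abs_sum_range_sub_le hnB K)
  have hS := abs_le.1 (abs_sum_range_sub_le hsB K)
  have hqx : x * ∑ k ∈ Finset.range K, (k : ℝ) ≤ ∑ k ∈ Finset.range K, (k : ℝ) * q k := by
    rw [Finset.mul_sum]
    refine Finset.sum_le_sum fun k _ => ?_
    rw [mul_comm]
    exact mul_le_mul_of_nonneg_left (hx k) (by positivity)
  have hrest := (abs_le.1 (abs_sum_reward_le hR i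
    (fun l => ρ (∑ k ∈ Finset.range K, n k + l)) b)).1
  have hKpos : (0 : ℝ) ≤ K := by positivity
  have hbR : (b : ℝ) * R ≤ R * (B + 1) * (K + 1) := by
    have : (b : ℝ) ≤ (B + 1) * (K + 1) := by nlinarith
    calc (b : ℝ) * R ≤ (B + 1) * (K + 1) * R := mul_le_mul_of_nonneg_right this hR0
      _ = _ := by ring
  have hgrow := hK₀ K hKK
  rw [prefixMP, le_div_iff₀ hNpos, Finset.sum_range_add, hs]
  push_cast at hT ⊢
  have hxN : x * ((∑ k ∈ Finset.range K, (n k : ℝ)) + b) ≤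
      x * ∑ k ∈ Finset.range K, (k : ℝ) + |x| * (2 * B + 1) * (K + 1) := by
    have h1 : |(∑ k ∈ Finset.range K, (n k : ℝ)) + b - ∑ k ∈ Finset.range K, (k : ℝ)| ≤
        (2 * B + 1) * (K + 1) := by
      have : (0 : ℝ) ≤ b := by positivity
      rw [abs_le]
      constructor <;> nlinarith
    have h2 := mul_le_mul_of_nonneg_left h1 (abs_nonneg x)
    rw [← abs_mul] at h2
    linarith [le_abs_self (x * (∑ k ∈ Finset.range K, (n k : ℝ) + b -
      ∑ k ∈ Finset.range K, (k : ℝ)))]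
  have hεN : ε * (∑ k ∈ Finset.range K, (k : ℝ) - B * K) ≤
      ε * ((∑ k ∈ Finset.range K, (n k : ℝ)) + b) := by
    refine mul_le_mul_of_nonneg_left ?_ hε.le
    have : (0 : ℝ) ≤ b := by positivity
    linarith
  have hBK : B * K ≤ B * (K + 1) := by nlinarith
  simp only [← add_assoc] at hrest ⊢
  linarith

/-- Stop after `K = a ^ 2` blocks. Those before `a` contribute `O(a ^ 2) = O(K)`, negligible against
a length of order `K ^ 2`, and all the others have value `x`. -/
theorem payoff_le_of_blocks (hn : ∀ k, 1 ≤ n k) (hnB : ∀ k, |(n k : ℝ) - k| ≤ B)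
    (hsB : ∀ k, |s k - k * q k| ≤ B)
    (hs : ∀ K, ∑ m ∈ Finset.range (∑ k ∈ Finset.range K, n k), (G.r i (ρ m) (ρ (m + 1)) : ℝ) =
      ∑ k ∈ Finset.range K, s k) {x P : ℝ} (hP : ∀ k, |q k| ≤ P)
    (hx : ∀ M, ∃ a ≥ M, ∀ k, a ≤ k → k < a ^ 2 → q k = x) : G.payoff ρ i ≤ x := by
  have hB : 0 ≤ B := (abs_nonneg _).trans (hnB 0)
  have hP0 : 0 ≤ P := (abs_nonneg _).trans (hP 0)
  refine payoff_le_iff.2 fun ε hε => frequently_atTop.2 fun M => ?_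
  obtain ⟨K₀, hK₀⟩ := exists_forall_ge_mul_le_sum_range (P + |x| + B + |x| * B) B hε
  obtain ⟨a, ha, hax⟩ := hx (max (max M K₀) 1)
  have haM : M ≤ a := (le_max_left _ _).trans ((le_max_left _ _).trans ha)
  have haK : K₀ ≤ a := (le_max_right _ _).trans ((le_max_left _ _).trans ha)
  have ha1 : 1 ≤ a := (le_max_right _ _).trans ha
  have haa : a ≤ a ^ 2 := Nat.le_self_pow two_ne_zero a
  set K := a ^ 2 with hK
  have hKT : K ≤ ∑ k ∈ Finset.range K, n k := by
    simpa using Finset.card_nsmul_le_sum (Finset.range K) n 1 fun k _ => hn k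
  refine ⟨∑ k ∈ Finset.range K, n k, by omega, ?_⟩
  have hNpos : (0 : ℝ) < (∑ k ∈ Finset.range K, n k : ℕ) := by exact_mod_cast (by omega)
  have hT := abs_le.1 (abs_sum_range_sub_le hnB K)
  have hS := abs_le.1 (abs_sum_range_sub_le hsB K)
  have hq : ∑ k ∈ Finset.range K, (k : ℝ) * q k ≤
      x * ∑ k ∈ Finset.range K, (k : ℝ) + (P + |x|) * K := by
    obtain ⟨b, hb⟩ := Nat.exists_eq_add_of_le haa
    rw [Finset.mul_sum, ← sub_le_iff_le_add', ← Finset.sum_sub_distrib, hb,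
      Finset.sum_range_add]
    have h1 : ∑ k ∈ Finset.range b, (((a + k : ℕ) : ℝ) * q (a + k) - x * ((a + k : ℕ) : ℝ)) = 0 :=
      Finset.sum_eq_zero fun k hk => by
        rw [hax (a + k) (by omega) (by have := Finset.mem_range.1 hk; omega)]
        ring
    have h2 : ∑ k ∈ Finset.range a, ((k : ℝ) * q k - x * k) ≤ a • ((P + |x|) * a) := by
      refine (Finset.sum_le_card_nsmul _ _ ((P + |x|) * a) fun k hk => ?_).trans_eq (by simp)
      have hka : (k : ℝ) ≤ a := by exact_mod_cast (Finset.mem_range.1 hk).le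
      have h3 : q k - x ≤ P + |x| := by
        linarith [(abs_le.1 (hP k)).2, neg_abs_le x]
      calc (k : ℝ) * q k - x * k = (q k - x) * k := by ring
        _ ≤ (P + |x|) * k := mul_le_mul_of_nonneg_right h3 (by positivity)
        _ ≤ (P + |x|) * a := mul_le_mul_of_nonneg_left hka (by positivity)
    rw [h1, add_zero, ← hb]
    refine h2.trans_eq ?_
    rw [hK, nsmul_eq_mul]
    push_cast
    ring
  have hgrow := hK₀ K (haK.trans haa)
  have hKpos : (0 : ℝ) ≤ K := by positivity
  rw [prefixMP, div_le_iff₀ hNpos, hs]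
  push_cast at hT ⊢
  have hxN : x * ∑ k ∈ Finset.range K, (k : ℝ) ≤
      x * (∑ k ∈ Finset.range K, (n k : ℝ)) + |x| * B * K := by
    have h2 := mul_le_mul_of_nonneg_left (abs_le.2 hT) (abs_nonneg x)
    rw [← abs_mul] at h2
    linarith [neg_abs_le (x * (∑ k ∈ Finset.range K, (n k : ℝ) - ∑ k ∈ Finset.range K, (k : ℝ)))]
  have hεN : ε * (∑ k ∈ Finset.range K, (k : ℝ) - B * K) ≤
      ε * (∑ k ∈ Finset.range K, (n k : ℝ)) := by
    refine mul_le_mul_of_nonneg_left ?_ hε.le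
    linarith
  have hC : 0 ≤ P + |x| + B + |x| * B := by positivity
  linarith

end Blocks

/-! ### The play realising a certificate -/

theorem exists_path_of_isAccessibleVia {v₀ : V} {W W' : Set V} (h : G.IsAccessibleVia v₀ W W') :
    ∃ w ∈ W, Relation.ReflTransGen (fun u v => u ∈ W' ∧ v ∈ W' ∧ (u, v) ∈ G.E) v₀ w := by
  obtain ⟨l, hl, hhead, ⟨w, hw, hlast⟩, rfl⟩ := h
  refine ⟨w, hw, ?_⟩
  induction l generalizing v₀ with
  | nil => simp at hhead
  | cons a l ih =>
    obtain rfl : a = v₀ := by simpa using hhead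
    cases l with
    | nil =>
      obtain rfl : a = w := by simpa using hlast
      exact .refl
    | cons b l =>
      rw [List.isChain_cons_cons] at hl
      refine .head ⟨by simp, by simp, hl.1⟩ (Relation.ReflTransGen.mono ?_ _ _
        (ih hl.2 rfl (by simpa using hlast)))
      exact fun u v h => ⟨List.mem_cons_of_mem _ h.1, List.mem_cons_of_mem _ h.2.1, h.2.2⟩

theorem exists_play_payoff_eq_combinedMP [Fintype ι] [Fintype V] {v₀ : V} {W W' : Set V}
    (hWW' : W ⊆ W') (hW : G.IsStronglyConnected W) (hacc : G.IsAccessibleVia v₀ W W')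
    (α : ι → G.SimpleCycle W → ℝ) (h0 : ∀ j c, 0 ≤ α j c) (h1 : ∀ j, ∑ c, α j c = 1) :
    ∃ ρ : ℕ → V, ρ 0 = v₀ ∧ G.IsPlay ρ ∧ (∀ n, ρ n ∈ W') ∧
      ∀ i, G.payoff ρ i = G.combinedMP α i := by
  obtain ⟨w, hw, hpath⟩ := exists_path_of_isAccessibleVia hacc
  have : Nonempty ι := ⟨G.owner v₀⟩
  obtain ⟨f, hf⟩ := exists_seq_const_on_long_blocks ι
  obtain ⟨B, hB, hwalk⟩ := exists_closed_walk_near hW hw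
  choose n s hn hns hnB hsB using fun k => hwalk (α (f k)) (h0 _) (h1 _) k
  obtain ⟨n₀, s₀, hw₀⟩ := HasWalk.of_reflTransGen (r := fun i u v => (G.r i u v : ℝ)) hpath
  have hns' : ∀ k, HasWalk (fun u v => u ∈ W' ∧ v ∈ W' ∧ (u, v) ∈ G.E)
      (fun i u v => (G.r i u v : ℝ)) w w (n k) (s k) := fun k => by
    obtain ⟨g, hg0, hgn, hgR, hgs⟩ := hns k
    exact ⟨g, hg0, hgn, fun l hl => ⟨hWW' (hgR l hl).1, hWW' (hgR l hl).2.1, (hgR l hl).2.2⟩, hgs⟩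
  -- The initial path is merged into block `0`, where it only enlarges the constant error bound.
  let n' : ℕ → ℕ := fun k => if k = 0 then n₀ + n 0 else n k
  let s' : ℕ → ι → ℝ := fun k => if k = 0 then s₀ + s 0 else s k
  have hn' : ∀ k, 1 ≤ n' k := fun k => by
    have := hn k
    have := hn 0
    simp only [n']
    split_ifs <;> omega
  obtain ⟨ρ, hρ0, hρR, hρs⟩ := HasWalk.exists_concat (a := fun k => if k = 0 then v₀ else w)
    (n := n') (s := s') hn' fun k => by
      rcases Nat.eq_zero_or_pos k with rfl | hk
      · simpa [n', s'] using hw₀.trans (hns' 0)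
      · simpa [n', s', hk.ne'] using hns' k
  have hnB' : ∀ k, |(n' k : ℝ) - k| ≤ B + n₀ + ∑ i, |s₀ i| := fun k => by
    have hs0 : 0 ≤ ∑ i, |s₀ i| := Finset.sum_nonneg fun _ _ => abs_nonneg _
    have hn0 : (0 : ℝ) ≤ n₀ := by positivity
    rcases Nat.eq_zero_or_pos k with rfl | hk
    · have := hnB 0
      simp only [n', if_pos]
      push_cast at this ⊢
      rw [abs_le] at this ⊢
      constructor <;> linarith
    · have := hnB k
      simp only [n', if_neg hk.ne']
      linarith
  have hsB' : ∀ i k, |s' k i - k * ∑ c, α (f k) c * G.cycleMP c i| ≤ B + n₀ + ∑ i, |s₀ i| :=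
    fun i k => by
      have hs0 : |s₀ i| ≤ ∑ i, |s₀ i| :=
        Finset.single_le_sum (f := fun i => |s₀ i|) (fun _ _ => abs_nonneg _) (Finset.mem_univ i)
      have hn0 : (0 : ℝ) ≤ n₀ := by positivity
      rcases Nat.eq_zero_or_pos k with rfl | hk
      · have := hsB 0 i
        simp only [s', if_pos, Pi.add_apply]
        rw [abs_le] at this hs0 ⊢
        constructor <;> linarith
      · have := hsB k i
        simp only [s', if_neg hk.ne']
        linarith [abs_nonneg (s₀ i)]
  refine ⟨ρ, by simpa using hρ0, fun m => (hρR m).2.2, fun m => (hρR m).1, fun i => ?_⟩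
  refine le_antisymm (le_ciInf fun j => ?_) ?_
  · obtain ⟨P, hP⟩ := (Set.finite_range fun j => |∑ c, α j c * G.cycleMP c i|).bddAbove
    refine payoff_le_of_blocks hn' hnB' (hsB' i) (fun K => hρs K i) (fun k => hP ⟨f k, rfl⟩)
      fun M => ?_
    obtain ⟨a, ha, haf⟩ := hf j M
    exact ⟨a, ha, fun k h1 h2 => by rw [haf k h1 h2]⟩
  · exact le_payoff_of_blocks hn' hnB' (hsB' i) (fun K => hρs K i)
      fun k => ciInf_le (Set.finite_range _).bddBelow (f k)

end MeanPayoffGame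

theorem mainTheorem4 :
    ∃ P₄ : Polynomial ℕ,
      ∀ (ι V : Type*) [Fintype ι] [Fintype V] (G : MeanPayoffGame ι V) (v₀ : V)
        (x y : ι → ℝ) (lam : V → EReal),
        (∃ ρ : ℕ → V, G.IsPlay ρ ∧ ρ 0 = v₀ ∧ G.IsConsistent lam ρ ∧
            x ≤ G.payoff ρ ∧ G.payoff ρ ≤ y) ↔
          ∃ (W W' : Set V) (α : ι → G.SimpleCycle W → ℝ),
            W ⊆ W' ∧
            (∀ j c, α j c ∈ Set.Icc (0 : ℝ) 1) ∧
            G.IsStronglyConnected W ∧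
            G.IsAccessibleVia v₀ W W' ∧
            (∀ i, ∑ c, α i c = 1) ∧
            (∀ i, x i ≤ G.combinedMP α i ∧ G.combinedMP α i ≤ y i) ∧
            (∀ i, ∀ v ∈ W', G.owner v = i → lam v ≤ ((G.combinedMP α i : ℝ) : EReal)) ∧
            sparseSize (fun d : ι × G.SimpleCycle W => α d.1 d.2) ≤
              Polynomial.aeval (instanceSize G x y lam) P₄ := by
  -- The final summand `.X` makes the value at `⊤` visibly `⊤`.
  refine ⟨.X * (.X + 2) * (1 + (1 + 2 * (2 * (.X + 2) ^ 2 +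
    2 * (.X * .X + 5 * .X) * (.X + 2) + 1))) + .X, fun ι V _ _ G v₀ x y lam => ⟨?_, ?_⟩⟩
  · rintro ⟨ρ, hρ, rfl, hlam, hx, hy⟩
    obtain ⟨W, W', α, hWW', h01, hW, hacc, h1, hxy, hl, hsize⟩ :=
      MeanPayoffGame.exists_certificate_of_play hρ hlam hx hy
    refine ⟨W, W', α, hWW', h01, hW, hacc, h1, hxy, hl, ?_⟩
    by_cases hS : instanceSize G x y lam = ⊤
    · simp [hS]
    · obtain ⟨S, hS'⟩ := ENat.ne_top_iff_exists.1 hS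
      refine (hsize S hS'.symm).trans ?_
      rw [← hS', map_add, Polynomial.aeval_X]
      refine le_trans (le_of_eq ?_) le_self_add
      simp [map_ofNat]
  · rintro ⟨W, W', α, hWW', h01, hW, hacc, h1, hxy, hl, -⟩
    obtain ⟨ρ, hρ0, hρ, hρW, hpay⟩ := MeanPayoffGame.exists_play_payoff_eq_combinedMP hWW' hW hacc
      α (fun j c => (h01 j c).1) h1
    refine ⟨ρ, hρ, hρ0, fun i n hi => ?_, fun i => ?_, fun i => ?_⟩
    · rw [MeanPayoffGame.payoff_shift, hpay]
      exact hl i _ (hρW n) hi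
    · rw [hpay]
      exact (hxy i).1
    · rw [hpay]
      exact (hxy i).2
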